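/- **Setting.** Let $r,s\ge 0$ be integers, $K=\mathbb C[q_1,\dots,q_r]$, $\partial_i=q_i\,\partial/\partial q_i$, and let $D^h$ be the ring of differential operators generated by $h\partial_1,\dots,h\partial_r$ with coefficients in $K[h]=\mathbb C[q_1,\dots,q_r,h]$. For $P=\sum_I f_I\,(h\partial)^I\in D^h$ with $f_I\in K[h]$ put $S(P)=\sum_I f_I\, b^I\in K[h][b_1,\dots,b_r]$. Let $|q_1|,\dots,|q_r|\ge 4$ be integers. Let $\mathcal A=K[b_1,\dots,b_r]/(\mathcal R_1,\dots,\mathcal R_u)$ be free of rank $s+1$ over $K$, put $R_j=\mathcal R_j|_{q=0}$ and $\mathcal A_0=\mathbb C[b_1,\dots,b_r]/(R_1,\dots,R_u)$, and assume that $\dim_{\mathbb C}\mathcal A_0=s+1$ and that the classes of $b_1,\dots,b_r$ in $\mathcal A_0$ are linearly independent (as they are when $\mathcal A_0=H^*M$ and $b_1,\dots,b_r$ is a basis of $H^2M$). Write $[c]$ and $[[c]]$ for classes in $\mathcal A$ and $\mathcal A_0$. Let $D^h_1,\dots,D^h_u\in D^h$ be homogeneous, where $h$ has degree $2$, $q_i$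 has degree $|q_i|$ and $\partial_i$ has degree $0$, and let $M^h=D^h/(D^h_1,\dots,D^h_u)$ (quotient by the left ideal) be a quantization of $\mathcal A$: $M^h$ is free over $K[h]$ of rank $s+1$, and $\lim_{h\to0}S(D^h_j)=\mathcal R_j$ for all $j$. The standard monomials are the monomials $(h\partial)^I$ that are not leading monomials of elements of the left ideal $(D^h_1,\dots,D^h_u)$, for the graded reverse lexicographic order with $\partial_1>\dots>\partial_r$. Assume that there are $s+1$ of them, $P_0,\dots,P_s$, that $[P_0],\dots,[P_s]$ is a $K[h]$-basis of $M^h$, and that with $c_j=\lim_{h\to0}S(P_j)$ the classes $[c_0],\dots,[c_s]$ form a $K$-basis of $\mathcal A$. Define matrices $\Omega^h_i$ (with $h\Omega_i^h$ polynomial in $q$ and $h$) and $\omega_i$ by $$[\partial_iP_j]=\sum_k(\Omega^h_i)_{kj}[P_k],\qquad [b_ic_j]=\sum_k(\omega_i)_{kj}[c_k]\qquad(1\le i\le r).$$ A *normalized gauge transformation* is an invertible matrix $L_+=Q_0(I+hQ_1+h^2Q_2+\cdots)$ of formal power series in $q$ and $h$ with $L_+|_{q=0}=I$ and $$\tfrac1h\,Q_0\,\omega_i\,Q_0^{-1}\,L_+=L_+\,\Omega^h_i-\partial_iL_+\qquad(1\le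 i\le r),$$ that is, one that transforms $d+\sum_i\Omega^h_i\,dt_i$ into $d+\frac1h\sum_i\hat\omega_i\,dt_i$, where $\hat\omega_i=Q_0\omega_iQ_0^{-1}$ and $q_i=e^{t_i}$. Put $\hat c_i=\sum_j(Q_0^{-1})_{ji}\,c_j$. **Corollary 4.2.** Under these hypotheses $r\le s$, and the standard monomials can be numbered so that $P_0=1$ and $P_i=h\partial_i$ for $1\le i\le r$. For every such numbering: 1. A normalized gauge transformation $L_+$ exists if and only if $\Omega^h_i|_{q=0}=\frac1h\,\omega_i|_{q=0}$ for all $i$. It is then unique, and $L_+$ and $L_+^{-1}$ are polynomial in $q$ and $h$. 2. If $L_+$ is the normalized gauge transformation, then $\hat c_0=c_0=1$ and $\hat c_i=c_i=b_i$ for $1\le i\le r$. 3. In the situation of 2, $\hat{\mathcal A}=\mathcal A$ and the quantum product comes from a change of basis: $[\hat c_0],\dots,[\hat c_s]$ is a $K$-basis of $\mathcal A$, in which multiplication by $b_i$ has the matrix $\hat\omega_i$. The $K$-linear map $\delta:\mathcal A\to K\otimes_{\mathbb C}\mathcal A_0$ with $\delta([\hat c_j])=[[\hat c_j|_{q=0}]]$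 for all $j$ is an isomorphism, and $\delta(1)=1$ and $\delta([b_i])=[[b_i]]$. For the quantum product $x\circ y=\delta(\delta^{-1}(x)\,\delta^{-1}(y))$ one has $\delta(xy)=\delta(x)\circ\delta(y)$, and $b_i\,\circ$ has the matrix $\hat\omega_i$ in the basis $[[\hat c_0|_{q=0}]],\dots,[[\hat c_s|_{q=0}]]$. -/

import Mathlib

open scoped TensorProduct

namespace DQuant

noncomputable section

/-! ## Coefficient rings -/

/-- The polynomial ring `K = ℂ[q₁, …, q_r]`. -/
abbrev K (r : ℕ) : Type := MvPolynomial (Fin r) ℂ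

/-- The polynomial ring `K[h] = ℂ[q₁, …, q_r, h]`, written as polynomials in the `q_i` with
coefficients in `ℂ[h]`. -/
abbrev Kh (r : ℕ) : Type := MvPolynomial (Fin r) (Polynomial ℂ)

/-- The formal completion `ℂ[[q₁, …, q_r]]` of `K`. -/
abbrev FK (r : ℕ) : Type := MvPowerSeries (Fin r) ℂ

/-- The formal completion `ℂ[[q₁, …, q_r, h]]` of `K[h]`, written as power series in the `q_i` with
coefficients in `ℂ[[h]]`. -/
abbrev FKh (r : ℕ) : Type := MvPowerSeries (Fin r) (PowerSeries ℂ)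

variable {r u s : ℕ}

/-- The specialization `h = 0`, from `K[h]` to `K`. -/
def hZero (r : ℕ) : Kh r →+* K r := MvPolynomial.map Polynomial.constantCoeff

/-- The specialization `q = 0`, from `K` to `ℂ`. -/
def qZero (r : ℕ) : K r →+* ℂ := MvPolynomial.constantCoeff

/-- The inclusion of `ℂ[q, h]` in `ℂ[[q, h]]`. -/
def toFKh (r : ℕ) : Kh r →+* FKh r :=
  MvPolynomial.coeToMvPowerSeries.ringHom.comp
    (MvPolynomial.map Polynomial.coeToPowerSeries.ringHom)

/-- The inclusion of `ℂ[q]` in `ℂ[[q]]`. -/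
def toFK (r : ℕ) : K r →+* FK r := MvPolynomial.coeToMvPowerSeries.ringHom

/-- The specialization `h = 0`, from `ℂ[[q, h]]` to `ℂ[[q]]`. -/
def hZeroF (r : ℕ) : FKh r →+* FK r := MvPowerSeries.map PowerSeries.constantCoeff

/-- The inclusion of `ℂ[[q]]` in `ℂ[[q, h]]`. -/
def FKtoFKh (r : ℕ) : FK r →+* FKh r := MvPowerSeries.map PowerSeries.C

/-- The variable `h` of `ℂ[[q, h]]`. -/
def hF (r : ℕ) : FKh r := MvPowerSeries.C PowerSeries.X

/-- The derivation `∂_i = q_i ∂/∂q_i = ∂/∂t_i` (where `q_i = exp t_i`) of `ℂ[[q, h]]`;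
it multiplies the coefficient of `q^a` by `a_i`. -/
def eulerF (i : Fin r) (f : FKh r) : FKh r :=
  fun a => (a i : PowerSeries ℂ) * MvPowerSeries.coeff a f

/-! ## The algebras `𝒜` and `𝒜₀` -/

/-- `𝒜 = K[b₁, …, b_r] / (ℛ₁, …, ℛ_u)`. -/
abbrev Alg (Rel : Fin u → MvPolynomial (Fin r) (K r)) : Type :=
  MvPolynomial (Fin r) (K r) ⧸ Ideal.span (Set.range Rel)

/-- The relation `R_j = ℛ_j|_{q = 0}`. -/
def relZero (Rel : Fin u → MvPolynomial (Fin r) (K r)) (j : Fin u) : MvPolynomial (Fin r) ℂ :=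
  MvPolynomial.map (qZero r) (Rel j)

/-- `𝒜₀ = ℂ[b₁, …, b_r] / (R₁, …, R_u)`. -/
abbrev AlgZero (Rel : Fin u → MvPolynomial (Fin r) (K r)) : Type :=
  MvPolynomial (Fin r) ℂ ⧸ Ideal.span (Set.range (relZero Rel))

/-- The class `[c]` in `𝒜` of a polynomial `c` in `b` and `q`. -/
def cls (Rel : Fin u → MvPolynomial (Fin r) (K r)) (c : MvPolynomial (Fin r) (K r)) : Alg Rel :=
  Ideal.Quotient.mk _ c

/-- The class `[[c]]` in `𝒜₀` of a polynomial `c` in `b`. -/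
def clsZero (Rel : Fin u → MvPolynomial (Fin r) (K r)) (c : MvPolynomial (Fin r) ℂ) :
    AlgZero Rel :=
  Ideal.Quotient.mk _ c

/-- `𝒜` is free of rank `s + 1` over `K`, and is a deformation of `𝒜₀`, which has the same
dimension. -/
structure IsDeformation (Rel : Fin u → MvPolynomial (Fin r) (K r)) (s : ℕ) : Prop where
  free : Module.Free (K r) (Alg Rel)
  rank : Module.finrank (K r) (Alg Rel) = s + 1
  rank_zero : Module.finrank ℂ (AlgZero Rel) = s + 1

/-! ## The ring `D^h` of differential operators -/

/-- The differential operator `h∂_i = h q_i ∂/∂q_i` on `K[h]`. -/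
def hEuler (i : Fin r) : Module.End (Polynomial ℂ) (Kh r) :=
  LinearMap.mulLeft (Polynomial ℂ) (MvPolynomial.C Polynomial.X * MvPolynomial.X i) ∘ₗ
    (MvPolynomial.pderiv i).toLinearMap

/-- The ring `D^h` of differential operators generated by `h∂₁, …, h∂_r` with coefficients in
`K[h]`. Elements of `D^h` are realized as operators on `K[h]`, on which `D^h` acts faithfully. -/
def Dh (r : ℕ) : Subring (Module.End (Polynomial ℂ) (Kh r)) :=
  Subring.closure
    (Set.range (fun f : Kh r => LinearMap.mulLeft (Polynomial ℂ) f) ∪ Set.range hEuler)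

/-- The generator `h∂_i` of `D^h`. -/
def hD (i : Fin r) : Dh r := ⟨hEuler i, Subring.subset_closure (Or.inr ⟨i, rfl⟩)⟩

/-- The inclusion of the coefficient ring `K[h]` in `D^h`: `f` acts by multiplication by `f`. -/
def coeffD (r : ℕ) : Kh r →+* Dh r :=
  (Algebra.lmul (Polynomial ℂ) (Kh r)).toRingHom.codRestrict (Dh r)
    (fun f => Subring.subset_closure (Or.inl ⟨f, rfl⟩))

/-- The monomial `(h∂)^I = (h∂₁)^{I₁} ⋯ (h∂_r)^{I_r}`. -/
def monD (I : Fin r →₀ ℕ) : Dh r := (List.ofFn fun i => hD i ^ I i).prod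

/-- The operator `∑_I f_I (h∂)^I` attached to the polynomial `∑_I f_I b^I` with `f_I ∈ K[h]`.
This is a bijection from `K[h][b₁, …, b_r]` to `D^h`; its inverse is the map `S`, which replaces
`h∂₁, …, h∂_r` by `b₁, …, b_r`. -/
def op (f : MvPolynomial (Fin r) (Kh r)) : Dh r :=
  ∑ I ∈ f.support, coeffD r (f.coeff I) * monD I

/-- The left ideal `(D₁^h, …, D_u^h)` of `D^h`, where `D_j^h = op (d j)`. -/
def leftIdeal (d : Fin u → MvPolynomial (Fin r) (Kh r)) : Submodule (Dh r) (Dh r) :=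
  Submodule.span (Dh r) (Set.range fun j => op (d j))

/-- The cyclic left `D^h`-module `M^h = D^h / (D₁^h, …, D_u^h)`. -/
def Mh (d : Fin u → MvPolynomial (Fin r) (Kh r)) : Type := Dh r ⧸ leftIdeal d

instance instAddCommGroupMh (d : Fin u → MvPolynomial (Fin r) (Kh r)) : AddCommGroup (Mh d) :=
  inferInstanceAs (AddCommGroup (Dh r ⧸ leftIdeal d))

instance instModuleDhMh (d : Fin u → MvPolynomial (Fin r) (Kh r)) : Module (Dh r) (Mh d) :=
  inferInstanceAs (Module (Dh r) (Dh r ⧸ leftIdeal d))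

/-- `M^h` as a `K[h]`-module, through the inclusion of `K[h]` in `D^h`. -/
instance instModuleMh (d : Fin u → MvPolynomial (Fin r) (Kh r)) : Module (Kh r) (Mh d) :=
  Module.compHom (Mh d) (coeffD r)

/-- The class `[P]` in `M^h` of an operator `P`. -/
def clsD (d : Fin u → MvPolynomial (Fin r) (Kh r)) (P : Dh r) : Mh d :=
  (leftIdeal d).mkQ P

/-- `M^h` is a quantization of `𝒜`: it is free over `K[h]` of rank `s + 1`, and
`lim_{h → 0} S(D_j^h) = ℛ_j` for all `j`. -/
structure IsQuantization (Rel : Fin u → MvPolynomial (Fin r) (K r))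
    (d : Fin u → MvPolynomial (Fin r) (Kh r)) (s : ℕ) : Prop where
  free : Module.Free (Kh r) (Mh d)
  rank : Module.finrank (Kh r) (Mh d) = s + 1
  limit : ∀ j, MvPolynomial.map (hZero r) (d j) = Rel j

/-- The operator `∑_I f_I (h∂)^I` is homogeneous, where `h` has degree `2`, `q_i` has degree `|q_i|`
and `∂_i` has degree `0`: all terms `h^k q^a (h∂)^I` that occur in it have the same degree
`2k + ∑ |q_i| a_i + 2|I|`. -/
def IsHomogeneousOp (qdeg : Fin r → ℕ) (f : MvPolynomial (Fin r) (Kh r)) : Prop :=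
  ∃ m : ℕ, ∀ (I a : Fin r →₀ ℕ) (k : ℕ),
    ((f.coeff I).coeff a).coeff k ≠ 0 → 2 * k + ∑ i, qdeg i * a i + 2 * I.degree = m

/-! ## Standard monomials -/

/-- The strict graded reverse lexicographic order on exponents, with `∂₁ > ⋯ > ∂_r`. -/
def GrevlexLT (I J : Fin r →₀ ℕ) : Prop :=
  I.degree < J.degree ∨
    (I.degree = J.degree ∧ ∃ k, (∀ l, k < l → I l = J l) ∧ J k < I k)

/-- `I` is the leading exponent of `f`, i.e. of the operator `op f`. -/
def IsLeadExp (f : MvPolynomial (Fin r) (Kh r)) (I : Fin r →₀ ℕ) : Prop :=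
  I ∈ f.support ∧ ∀ J ∈ f.support, J ≠ I → GrevlexLT J I

/-- The exponents of the standard monomials of the left ideal `(D₁^h, …, D_u^h)`: those that are not
leading exponents of elements of the ideal, i.e. are not divisible by the leading exponent of any
element of a Gröbner basis. -/
def standardExps (d : Fin u → MvPolynomial (Fin r) (Kh r)) : Set (Fin r →₀ ℕ) :=
  {I | ∀ f, op f ∈ leftIdeal d → ¬ IsLeadExp f I}

/-- An enumeration `P₀, …, P_s` of the standard monomials in `h∂₁, …, h∂_r`, such that
`[P₀], …, [P_s]` form a `K[h]`-basis of `M^h` and the classes of the `c_j = lim_{h → 0} S(P_j)` form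
a `K`-basis of `𝒜`. -/
structure StandardBasis (Rel : Fin u → MvPolynomial (Fin r) (K r))
    (d : Fin u → MvPolynomial (Fin r) (Kh r)) (s : ℕ) where
  /-- `P_j = (h∂)^(exp j)` and `c_j = b^(exp j)`. -/
  exp : Fin (s + 1) → (Fin r →₀ ℕ)
  injective : Function.Injective exp
  range_eq : Set.range exp = standardExps d
  /-- The basis `[P₀], …, [P_s]` of `M^h`. -/
  P : Module.Basis (Fin (s + 1)) (Kh r) (Mh d)
  P_apply : ∀ j, P j = clsD d (monD (exp j))
  /-- The basis `[c₀], …, [c_s]` of `𝒜`. -/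
  c : Module.Basis (Fin (s + 1)) (K r) (Alg Rel)
  c_apply : ∀ j, c j = cls Rel (MvPolynomial.monomial (exp j) 1)

namespace StandardBasis

variable {Rel : Fin u → MvPolynomial (Fin r) (K r)} {d : Fin u → MvPolynomial (Fin r) (Kh r)}

/-- The enumeration starts with `P₀ = 1`, `P₁ = h∂₁`, …, `P_r = h∂_r` (in particular `r ≤ s`). -/
def IsAdapted (B : StandardBasis Rel d s) : Prop :=
  B.exp 0 = 0 ∧ ∀ i : Fin r, ∃ hi : (i : ℕ) + 1 < s + 1, B.exp ⟨i + 1, hi⟩ = Finsupp.single i 1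

/-- The matrix `hΩ_i^h` of the connection form multiplied by `h`:
`[h∂_i P_j] = ∑_k (hΩ_i^h)_{kj} [P_k]`. -/
def hOmega (B : StandardBasis Rel d s) (i : Fin r) : Matrix (Fin (s + 1)) (Fin (s + 1)) (Kh r) :=
  Matrix.of fun k j => B.P.repr (hD i • B.P j) k

/-- The matrix `ω_i` of multiplication by `b_i` on `𝒜`: `[b_i c_j] = ∑_k (ω_i)_{kj} [c_k]`. -/
def omega (B : StandardBasis Rel d s) (i : Fin r) : Matrix (Fin (s + 1)) (Fin (s + 1)) (K r) :=
  LinearMap.toMatrix B.c B.c (LinearMap.mulLeft (K r) (cls Rel (MvPolynomial.X i)))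

/-- At `q = 0` the connection form has no other term than its polar part:
`Ω_i^h|_{q=0} = (1/h) ω_i|_{q=0}` for all `i`. -/
def IsPolarAtZero (B : StandardBasis Rel d s) : Prop :=
  ∀ i k j, MvPolynomial.constantCoeff (B.hOmega i k j) = Polynomial.C (qZero r (B.omega i k j))

/-- The value `Q₀` at `h = 0` of `L₊ = Q₀ (I + h Q₁ + h² Q₂ + ⋯)`. -/
def Q₀F (L : Matrix (Fin (s + 1)) (Fin (s + 1)) (FKh r)) :
    Matrix (Fin (s + 1)) (Fin (s + 1)) (FK r) := L.map (hZeroF r)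

/-- `L = L₊` is a normalized gauge transformation: an invertible matrix of power series in `q` and
`h` with `L₊|_{q = 0} = I` which transforms `d + Ω^h` into `d + (1/h) Q₀ ω Q₀⁻¹`, i.e.
`(1/h) Q₀ ω Q₀⁻¹ L₊ = L₊ Ω^h - d L₊`. (The equation is multiplied by `h`.) -/
structure IsNormalizedGauge (B : StandardBasis Rel d s)
    (L : Matrix (Fin (s + 1)) (Fin (s + 1)) (FKh r)) : Prop where
  isUnit : IsUnit L
  normalized : L.map (MvPowerSeries.constantCoeff (σ := Fin r) (R := PowerSeries ℂ)) = 1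
  gauge : ∀ i : Fin r,
    (Q₀F L * (B.omega i).map (toFK r) * (Q₀F L)⁻¹).map (FKtoFKh r) * L =
      L * (B.hOmega i).map (toFKh r) - hF r • L.map (eulerF i)

/-- `ĉ_i = ∑_j (Q₀⁻¹)_{ji} c_j`, as a polynomial in `b` and `q`. -/
def cHat (B : StandardBasis Rel d s) (Q₀ : Matrix (Fin (s + 1)) (Fin (s + 1)) (K r))
    (i : Fin (s + 1)) : MvPolynomial (Fin r) (K r) :=
  ∑ j, MvPolynomial.monomial (B.exp j) (Q₀⁻¹ j i)

/-- The polynomial `ĉ_i|_{q = 0}` in `b`. -/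
def cHatZero (B : StandardBasis Rel d s) (Q₀ : Matrix (Fin (s + 1)) (Fin (s + 1)) (K r))
    (i : Fin (s + 1)) : MvPolynomial (Fin r) ℂ :=
  MvPolynomial.map (qZero r) (B.cHat Q₀ i)

end StandardBasis

/-- The quantum product `x ∘ y = δ(δ⁻¹(x) δ⁻¹(y))` on `K ⊗ 𝒜₀` attached to an isomorphism `δ` of
`K`-modules from `𝒜` to `K ⊗ 𝒜₀`. -/
def qProd {Rel : Fin u → MvPolynomial (Fin r) (K r)} (δ : Alg Rel ≃ₗ[K r] K r ⊗[ℂ] AlgZero Rel)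
    (x y : K r ⊗[ℂ] AlgZero Rel) : K r ⊗[ℂ] AlgZero Rel :=
  δ (δ.symm x * δ.symm y)

end

end DQuant

open DQuant

set_option linter.unusedSectionVars false

namespace DQuant

noncomputable section

variable {r : ℕ} {ι : Type*} [Fintype ι] [DecidableEq ι]

/-! ## Nilpotent matrices and the equation `N x_m + A x_{m+1} = f_m` -/

/-! Write `W i` for `hΩ_i^h`. A normalized gauge transformation takes `h∂_i + W i` to some `h∂_i + V
i` with `V i` free of `h`. Conversely, if `g` is the identity at `q = 0` and makes all `V i` free of
`h`, then setting `h = 0` in `V i * g = g * W i - h∂_i g` gives `V i = Q₀ ω_i Q₀⁻¹`, because `W i`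
becomes `ω_i` at `h = 0` (`hZero_hOmega`). So the task is to remove `h` from the connection.

Two properties of `W` make this possible. It is flat, since the `h∂_i` commute (`hOmega_flat`). It
is homogeneous of degree 2 when `P_j` has degree `2 |exp j|`, since the rescaling `q_i ↦ c^{|q_i|}
q_i`, `h ↦ c² h` acts on `M^h` with the `P_j` as eigenvectors (`hOmega_coeff`). Hence at `q = h = 0`
the matrix of `W i` raises the weight by one, so commutation with `w = ∑ W i |_{q=h=0}` is a
nilpotent operator `ad w`.

Existence goes by induction on `|a|` for the coefficients of `q^a` (`exists_gauge_step`). The sum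
`h∑∂_i` multiplies `q^a` by `h|a|`, so removing the positive powers of `h` from `∑ V i` in degree
`|a| = N + 1` by a gauge `1 + X` amounts to solving `(N + 1) X_m + ad w X_{m+1} = f_m`, which is
possible since `ad w` is nilpotent. Flatness then gives the homogeneous version of this equation for
each single `V i`, and nilpotency kills its positive powers of `h`. Homogeneity bounds the `|a|`
that occur, so finitely many steps suffice. Uniqueness (`gauge_unique`) comes from the same
recurrence, applied to the lowest coefficients of a difference. At `q = 0` the gauge equation reads
`V i = W i`, so the polar condition is necessary.

The transformation is homogeneous of degree 0, hence polynomial, and unipotent for the weight, so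
its inverse is polynomial too. As `|q_i| ≥ 4`, its columns of weight at most one are trivial at `h =
0`, which gives `ĉ_0 = 1` and `ĉ_i = b_i`. As `Q₀` is the identity at `q = 0`, `δ` matches the bases
`[ĉ_j]` and `[[c_j]]`.

An adapted numbering exists because `1, b_1, …, b_r` are independent in `𝒜₀`: independence at `q = h
= 0` lifts to `M^h` (`coeff_eq_zero_of_sum_eq_zero`), so none of `1, h∂_1, …, h∂_r` can be a leading
monomial of the ideal. -/

theorem matrix_pow_apply_ne_zero {R : Type*} [CommRing R] {M : Matrix ι ι R} {n : ι → ℕ}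
    (h : ∀ k j, M k j ≠ 0 → n k < n j) (p : ℕ) :
    ∀ k j, (M ^ p) k j ≠ 0 → n k + p ≤ n j := by
  induction p with
  | zero =>
    intro k j hkj
    by_cases e : k = j
    · simp [e]
    · simp [e] at hkj
  | succ p ih =>
    intro k j hkj
    rw [pow_succ, Matrix.mul_apply] at hkj
    obtain ⟨l, -, hl⟩ := Finset.exists_ne_zero_of_sum_ne_zero hkj
    have h1 := ih k l (left_ne_zero_of_mul hl)
    have h2 := h l j (right_ne_zero_of_mul hl)
    omega

/-- Each factor of a power costs at least one unit of weight, and all weights are bounded by their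
sum. -/
theorem isNilpotent_of_strictlyTriangular {R : Type*} [CommRing R] {M : Matrix ι ι R} {n : ι → ℕ}
    (h : ∀ k j, M k j ≠ 0 → n k < n j) : IsNilpotent M := by
  refine ⟨(∑ j, n j) + 1, ?_⟩
  ext k j
  by_contra hkj
  have h1 := matrix_pow_apply_ne_zero h _ k j hkj
  have h2 : n j ≤ ∑ j, n j := Finset.single_le_sum (fun _ _ => Nat.zero_le _) (Finset.mem_univ j)
  omega

theorem isNilpotent_of_strictlyLowerTriangular {R : Type*} [CommRing R] {M : Matrix ι ι R}
    {n : ι → ℕ} (h : ∀ k j, M k j ≠ 0 → n j < n k) : IsNilpotent M := by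
  -- Reflecting the weights exchanges lower and upper triangular; no natural subtraction truncates,
  -- since each weight is at most the sum.
  refine isNilpotent_of_strictlyTriangular (n := fun k => (∑ j, n j) - n k) fun k j hkj => ?_
  have h1 := h k j hkj
  have h2 : n k ≤ ∑ j, n j := Finset.single_le_sum (fun _ _ => Nat.zero_le _) (Finset.mem_univ k)
  omega

theorem isUnit_of_unipotent {R : Type*} [CommRing R] {M : Matrix ι ι R} {n : ι → ℕ}
    (h : ∀ k j, (M - 1) k j ≠ 0 → n k < n j) : IsUnit M := by
  have := (isNilpotent_of_strictlyTriangular h).isUnit_one_add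
  rwa [add_sub_cancel] at this

/-- The commutator with a matrix. -/
def adMat (w : Matrix ι ι ℂ) : Module.End ℂ (Matrix ι ι ℂ) :=
  LinearMap.mulLeft ℂ w - LinearMap.mulRight ℂ w

theorem adMat_apply (w x : Matrix ι ι ℂ) : adMat w x = w * x - x * w := rfl

/-- Left and right multiplication by `w` are commuting nilpotent operators. -/
theorem isNilpotent_adMat {w : Matrix ι ι ℂ} (h : IsNilpotent w) : IsNilpotent (adMat w) :=
  (LinearMap.commute_mulLeft_right w w).isNilpotent_sub
    (by rwa [LinearMap.isNilpotent_mulLeft_iff]) (by rwa [LinearMap.isNilpotent_mulRight_iff])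

section Recurrence

variable {V : Type*} [AddCommGroup V] [Module ℂ V]

/-- The equation expresses `x m` through `x (m + 1)`. Iterating it `p` times puts `A ^ p` in front,
so no finiteness or decay of the sequence is needed. -/
theorem eq_zero_of_recurrence {A : Module.End ℂ V} (hA : IsNilpotent A) {N : ℂ} (hN : N ≠ 0)
    {x : ℕ → V} {m₀ : ℕ} (h : ∀ m, m₀ ≤ m → N • x m + A (x (m + 1)) = 0) (m : ℕ) (hm : m₀ ≤ m) :
    x m = 0 := by
  have key : ∀ p m, m₀ ≤ m → N ^ p • x m = (-1 : ℂ) ^ p • (A ^ p) (x (m + p)) := by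
    intro p
    induction p with
    | zero => simp
    | succ p ih =>
      intro m hm
      have h1 : N • x m = - A (x (m + 1)) := eq_neg_of_add_eq_zero_left (h m hm)
      rw [pow_succ, mul_smul, h1, smul_neg, ← map_smul, ih (m + 1) (by omega), pow_succ' A,
        Module.End.mul_apply, map_smul, pow_succ, mul_smul, neg_one_smul, smul_neg,
        show m + 1 + p = m + (p + 1) by ring]
  obtain ⟨p, hp⟩ := hA
  have := key p m hm
  rw [hp, LinearMap.zero_apply, smul_zero] at this
  exact (smul_eq_zero.1 this).resolve_left (pow_ne_zero _ hN)

/-- The solution of the equation `N x_m + A x_{m+1} = f_m` for nilpotent `A`. -/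
def recurrenceSol (A : Module.End ℂ V) (p : ℕ) (N : ℂ) (f : ℕ → V) (m : ℕ) : V :=
  ∑ k ∈ Finset.range p, ((-N⁻¹) • A) ^ k • (N⁻¹ • f (m + k))

/-- With `B = -N⁻¹ A` and `T` the shift of sequences, the equation is `N (1 - B T) x = f`; the
geometric series for `(1 - B T)⁻¹` stops because `B ^ p = 0`. -/
theorem recurrenceSol_spec {A : Module.End ℂ V} {p : ℕ} (hp : A ^ p = 0) {N : ℂ} (hN : N ≠ 0)
    (f : ℕ → V) (m : ℕ) :
    N • recurrenceSol A p N f m + A (recurrenceSol A p N f (m + 1)) = f m := by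
  set B : Module.End ℂ V := (-N⁻¹) • A with hB
  have hBp : B ^ p = 0 := by rw [hB, smul_pow, hp, smul_zero]
  have hAB : ∀ v, A v = -(N • B v) := by
    intro v
    rw [hB, LinearMap.smul_apply, smul_smul, mul_neg, mul_inv_cancel₀ hN, neg_one_smul, neg_neg]
  have h1 : recurrenceSol A p N f m = N⁻¹ • f m + B (recurrenceSol A p N f (m + 1)) := by
    have h2 : B (recurrenceSol A p N f (m + 1)) =
        ∑ k ∈ Finset.range p, B ^ (k + 1) • (N⁻¹ • f (m + (k + 1))) := by
      rw [recurrenceSol, map_sum]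
      refine Finset.sum_congr rfl fun k _ => ?_
      rw [pow_succ', add_right_comm]
      rfl
    have h3 := Finset.sum_range_succ' (fun k => B ^ k • (N⁻¹ • f (m + k))) p
    rw [Finset.sum_range_succ, hBp] at h3
    rw [h2, add_comm]
    simpa [recurrenceSol, hB] using h3
  rw [hAB, h1, smul_add, smul_smul, mul_inv_cancel₀ hN, one_smul]
  abel

/-- This carries homogeneity from the right-hand side to the solution: `A ^ k` undoes the shift of
the index by `k`. -/
theorem recurrenceSol_mem {A : Module.End ℂ V} {S : ℕ → Submodule ℂ V}
    (hA : ∀ m, ∀ v ∈ S (m + 1), A v ∈ S m) (p : ℕ) (N : ℂ) {f : ℕ → V} (hf : ∀ m, f m ∈ S m)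
    (m : ℕ) : recurrenceSol A p N f m ∈ S m := by
  refine Submodule.sum_mem _ fun k _ => ?_
  have : ∀ k m, ∀ v ∈ S (m + k), (((-N⁻¹) • A) ^ k) v ∈ S m := by
    intro k
    induction k with
    | zero => simp
    | succ k ih =>
      intro m v hv
      rw [pow_succ, Module.End.mul_apply]
      refine ih m _ (Submodule.smul_mem _ _ (hA _ _ ?_))
      rwa [add_assoc]
  exact this k m _ (Submodule.smul_mem _ _ (hf _))

end Recurrence

end

noncomputable section

variable {r : ℕ} {ι : Type*} [Fintype ι] [DecidableEq ι]

/-! ## Matrices of power series -/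

/-- The coefficient of `q^a` of a matrix of power series. -/
def qCoeff (a : Fin r →₀ ℕ) : Matrix ι ι (FKh r) →+ Matrix ι ι (PowerSeries ℂ) :=
  (MvPowerSeries.coeff a).toAddMonoidHom.mapMatrix

/-- The coefficient of `h^m` of a matrix of power series. -/
def hCoeff (m : ℕ) : Matrix ι ι (PowerSeries ℂ) →+ Matrix ι ι ℂ :=
  (PowerSeries.coeff m).toAddMonoidHom.mapMatrix

theorem qCoeff_apply (a : Fin r →₀ ℕ) (M : Matrix ι ι (FKh r)) (k j : ι) :
    qCoeff a M k j = MvPowerSeries.coeff a (M k j) := rfl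

theorem hCoeff_apply (m : ℕ) (M : Matrix ι ι (PowerSeries ℂ)) (k j : ι) :
    hCoeff m M k j = PowerSeries.coeff m (M k j) := rfl

theorem ext_qCoeff {M N : Matrix ι ι (FKh r)} (h : ∀ a, qCoeff a M = qCoeff a N) : M = N := by
  ext k j : 1
  refine MvPowerSeries.ext fun a => ?_
  exact congrFun (congrFun (h a) k) j

theorem ext_hCoeff {M N : Matrix ι ι (PowerSeries ℂ)} (h : ∀ a, hCoeff a M = hCoeff a N) :
    M = N := by
  ext k j : 1
  refine PowerSeries.ext fun a => ?_
  exact congrFun (congrFun (h a) k) j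

theorem qCoeff_mul (a : Fin r →₀ ℕ) (M N : Matrix ι ι (FKh r)) :
    qCoeff a (M * N) = ∑ p ∈ Finset.HasAntidiagonal.antidiagonal a, qCoeff p.1 M * qCoeff p.2 N := by
  classical
  ext k j : 1
  simp only [qCoeff_apply, Matrix.mul_apply, map_sum, MvPowerSeries.coeff_mul, Matrix.sum_apply]
  rw [Finset.sum_comm]

theorem hCoeff_mul (m : ℕ) (M N : Matrix ι ι (PowerSeries ℂ)) :
    hCoeff m (M * N) = ∑ p ∈ Finset.HasAntidiagonal.antidiagonal m, hCoeff p.1 M * hCoeff p.2 N := by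
  ext k j : 1
  simp only [hCoeff_apply, Matrix.mul_apply, map_sum, PowerSeries.coeff_mul, Matrix.sum_apply]
  rw [Finset.sum_comm]

theorem qCoeff_one (a : Fin r →₀ ℕ) :
    qCoeff a (1 : Matrix ι ι (FKh r)) = if a = 0 then 1 else 0 := by
  classical
  ext k j : 1
  rw [qCoeff_apply, Matrix.one_apply]
  by_cases h1 : k = j <;> by_cases h2 : a = 0 <;>
    simp [h1, h2, MvPowerSeries.coeff_one, Matrix.one_apply]

theorem qCoeff_mul_zero (M N : Matrix ι ι (FKh r)) :
    qCoeff 0 (M * N) = qCoeff 0 M * qCoeff 0 N := by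
  simp [qCoeff_mul]

/-- A matrix of power series in `h` that does not depend on `h`. -/
def HConst (M : Matrix ι ι (PowerSeries ℂ)) : Prop := ∀ m, hCoeff (m + 1) M = 0

theorem HConst.hCoeff_mul {M : Matrix ι ι (PowerSeries ℂ)} (hM : HConst M)
    (N : Matrix ι ι (PowerSeries ℂ)) (m : ℕ) : hCoeff m (M * N) = hCoeff 0 M * hCoeff m N := by
  rw [DQuant.hCoeff_mul]
  refine Finset.sum_eq_single_of_mem (0, m) (by simp) fun p _ hp' => ?_
  obtain ⟨p1, p2⟩ := p
  cases p1 with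
  | zero => simp_all
  | succ n => rw [hM n, zero_mul]

theorem HConst.hCoeff_mul_right {N : Matrix ι ι (PowerSeries ℂ)} (hN : HConst N)
    (M : Matrix ι ι (PowerSeries ℂ)) (m : ℕ) : hCoeff m (M * N) = hCoeff m M * hCoeff 0 N := by
  rw [DQuant.hCoeff_mul]
  refine Finset.sum_eq_single_of_mem (m, 0) (by simp) fun p _ hp' => ?_
  obtain ⟨p1, p2⟩ := p
  cases p2 with
  | zero => simp_all
  | succ n => rw [hN n, mul_zero]

theorem HConst.mul {M N : Matrix ι ι (PowerSeries ℂ)} (hM : HConst M) (hN : HConst N) :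
    HConst (M * N) := fun m => by rw [hM.hCoeff_mul, hN m, mul_zero]

theorem HConst.sum {α : Type*} {s : Finset α} {M : α → Matrix ι ι (PowerSeries ℂ)}
    (h : ∀ i ∈ s, HConst (M i)) : HConst (∑ i ∈ s, M i) := fun m => by
  rw [map_sum]
  exact Finset.sum_eq_zero fun i hi => h i hi m

/-! ### The derivations `h∂_i` -/

theorem coeff_eulerF (i : Fin r) (f : FKh r) (a : Fin r →₀ ℕ) :
    MvPowerSeries.coeff a (eulerF i f) = (a i : PowerSeries ℂ) * MvPowerSeries.coeff a f := rfl

theorem eulerF_add (i : Fin r) (f g : FKh r) : eulerF i (f + g) = eulerF i f + eulerF i g := by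
  ext a : 1
  simp only [coeff_eulerF, map_add, mul_add]

theorem eulerF_mul (i : Fin r) (f g : FKh r) :
    eulerF i (f * g) = eulerF i f * g + f * eulerF i g := by
  classical
  ext a : 1
  simp only [coeff_eulerF, map_add, MvPowerSeries.coeff_mul, Finset.mul_sum]
  rw [← Finset.sum_add_distrib]
  refine Finset.sum_congr rfl fun p hp => ?_
  have : a i = p.1 i + p.2 i := by rw [← Finset.HasAntidiagonal.mem_antidiagonal.1 hp]; rfl
  rw [this]
  push_cast
  ring

theorem eulerF_comm (i l : Fin r) (f : FKh r) : eulerF i (eulerF l f) = eulerF l (eulerF i f) := by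
  ext a : 1
  simp only [coeff_eulerF]
  ring

/-- The derivation `h∂_i` of the ring of matrices of power series. -/
def matD (i : Fin r) : Matrix ι ι (FKh r) →+ Matrix ι ι (FKh r) :=
  AddMonoidHom.mk' (fun M => hF r • M.map (eulerF i)) fun M N => by
    ext k j : 1
    simp [eulerF_add, mul_add]

theorem matD_apply (i : Fin r) (M : Matrix ι ι (FKh r)) : matD i M = hF r • M.map (eulerF i) := rfl

theorem matD_mul (i : Fin r) (M N : Matrix ι ι (FKh r)) :
    matD i (M * N) = matD i M * N + M * matD i N := by
  ext k j : 1
  have h0 : ∀ (s : Finset ι) (f : ι → FKh r), eulerF i (∑ l ∈ s, f l) = ∑ l ∈ s, eulerF i (f l) :=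
    fun s f => map_sum (AddMonoidHom.mk' (eulerF i) (eulerF_add i)) f s
  simp only [matD_apply, Matrix.smul_apply, Matrix.add_apply, Matrix.mul_apply, Matrix.map_apply,
    h0, smul_eq_mul, Finset.mul_sum, ← Finset.sum_add_distrib, eulerF_mul]
  refine Finset.sum_congr rfl fun l _ => ?_
  ring

theorem eulerF_hF_mul (i : Fin r) (f : FKh r) : eulerF i (hF r * f) = hF r * eulerF i f := by
  ext a : 1
  simp only [coeff_eulerF, hF, MvPowerSeries.coeff_C_mul]
  ring

theorem matD_comm (i l : Fin r) (M : Matrix ι ι (FKh r)) :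
    matD i (matD l M) = matD l (matD i M) := by
  ext k j : 1
  simp only [matD_apply, Matrix.smul_apply, Matrix.map_apply, smul_eq_mul, eulerF_hF_mul]
  rw [eulerF_comm]

theorem qCoeff_matD (i : Fin r) (M : Matrix ι ι (FKh r)) (a : Fin r →₀ ℕ) :
    qCoeff a (matD i M) = (PowerSeries.X * (a i : PowerSeries ℂ)) • qCoeff a M := by
  ext k j : 1
  simp only [matD_apply, qCoeff_apply, Matrix.smul_apply, Matrix.map_apply, smul_eq_mul, hF,
    MvPowerSeries.coeff_C_mul, coeff_eulerF]
  ring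

theorem hCoeff_succ_smul (c : ℕ) (M : Matrix ι ι (PowerSeries ℂ)) (m : ℕ) :
    hCoeff (m + 1) ((PowerSeries.X * (c : PowerSeries ℂ)) • M) = (c : ℂ) • hCoeff m M := by
  ext k j : 1
  simp only [hCoeff_apply, Matrix.smul_apply, smul_eq_mul, mul_assoc, PowerSeries.coeff_succ_X_mul]
  rw [← map_natCast (PowerSeries.C (R := ℂ)), PowerSeries.coeff_C_mul]

theorem hCoeff_zero_smul (c : PowerSeries ℂ) (M : Matrix ι ι (PowerSeries ℂ)) :
    hCoeff 0 ((PowerSeries.X * c) • M) = 0 := by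
  ext k j : 1
  simp [hCoeff_apply, mul_assoc, PowerSeries.coeff_zero_X_mul]

/-- The operator `h∑∂_i` acts on `q^a` by `h |a|`, with `|a| ≠ 0` for `a ≠ 0`; a single `∂_i` may
kill `q^a`. -/
theorem sum_smul_qCoeff (a : Fin r →₀ ℕ) (M : Matrix ι ι (PowerSeries ℂ)) :
    ∑ i, (PowerSeries.X * (a i : PowerSeries ℂ)) • M =
      (PowerSeries.X * (a.degree : PowerSeries ℂ)) • M := by
  rw [← Finset.sum_smul, ← Finset.mul_sum, Finsupp.degree_eq_sum]
  push_cast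
  rfl

/-! ### Products and the degree in `q` -/

theorem qCoeff_mul_eq_zero {M X : Matrix ι ι (FKh r)} {n : ℕ}
    (hX : ∀ a : Fin r →₀ ℕ, a.degree ≤ n → qCoeff a X = 0) (a : Fin r →₀ ℕ) (ha : a.degree ≤ n) :
    qCoeff a (M * X) = 0 ∧ qCoeff a (X * M) = 0 := by
  rw [qCoeff_mul, qCoeff_mul]
  constructor <;>
  · refine Finset.sum_eq_zero fun p hp => ?_
    have : p.1.degree + p.2.degree = a.degree := by
      rw [← map_add, Finset.HasAntidiagonal.mem_antidiagonal.1 hp]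
    simp [hX p.1 (by omega), hX p.2 (by omega)]

/-- As `X` starts in degree `n + 1`, only the constant term of `M` reaches that degree. -/
theorem qCoeff_mul_low {M X : Matrix ι ι (FKh r)} {n : ℕ}
    (hX : ∀ a : Fin r →₀ ℕ, a.degree ≤ n → qCoeff a X = 0) (a : Fin r →₀ ℕ)
    (ha : a.degree = n + 1) :
    qCoeff a (M * X) = qCoeff 0 M * qCoeff a X ∧ qCoeff a (X * M) = qCoeff a X * qCoeff 0 M := by
  rw [qCoeff_mul, qCoeff_mul]
  have hdeg : ∀ p ∈ Finset.HasAntidiagonal.antidiagonal a, p.1.degree + p.2.degree = n + 1 := fun p hp => by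
    rw [← ha, ← map_add, Finset.HasAntidiagonal.mem_antidiagonal.1 hp]
  constructor
  · refine Finset.sum_eq_single_of_mem (0, a) (by simp) fun p hp hp' => ?_
    have h1 := hdeg p hp
    rw [hX p.2, mul_zero]
    by_contra h2
    have h3 : p.1 = 0 := (Finsupp.degree_eq_zero_iff _).1 (by omega)
    have h4 := Finset.HasAntidiagonal.mem_antidiagonal.1 hp
    rw [h3, zero_add] at h4
    exact hp' (Prod.ext h3 h4)
  · refine Finset.sum_eq_single_of_mem (a, 0) (by simp) fun p hp hp' => ?_
    have h1 := hdeg p hp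
    rw [hX p.1, zero_mul]
    by_contra h2
    have h3 : p.2 = 0 := (Finsupp.degree_eq_zero_iff _).1 (by omega)
    have h4 := Finset.HasAntidiagonal.mem_antidiagonal.1 hp
    rw [h3, add_zero] at h4
    exact hp' (Prod.ext h4 h3)

/-- The coefficients of `q^a` with `|a| ≤ n` do not depend on `h`. -/
def HConstUpTo (n : ℕ) (M : Matrix ι ι (FKh r)) : Prop :=
  ∀ a : Fin r →₀ ℕ, a.degree ≤ n → HConst (qCoeff a M)

/-- Apart from the two extreme terms, both factors have degree at most `n` and are free of `h`, so
their products do not reach positive powers of `h`. -/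
theorem HConstUpTo.hCoeff_qCoeff_mul {M N : Matrix ι ι (FKh r)} {n : ℕ} (hM : HConstUpTo n M)
    (hN : HConstUpTo n N) (a : Fin r →₀ ℕ) (ha : a.degree = n + 1) (m : ℕ) :
    hCoeff (m + 1) (qCoeff a (M * N)) =
      hCoeff 0 (qCoeff 0 M) * hCoeff (m + 1) (qCoeff a N) +
        hCoeff (m + 1) (qCoeff a M) * hCoeff 0 (qCoeff 0 N) := by
  have ha0 : a ≠ 0 := by rintro rfl; simp at ha
  rw [qCoeff_mul, map_sum]
  rw [Finset.sum_eq_add_of_mem (0, a) (a, 0) (by simp) (by simp) (by simp [ha0.symm])]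
  · rw [(hM 0 (by simp)).hCoeff_mul, (hN 0 (by simp)).hCoeff_mul_right]
  · rintro p hp ⟨h1, h2⟩
    have h4 := Finset.HasAntidiagonal.mem_antidiagonal.1 hp
    have hdeg : p.1.degree + p.2.degree = n + 1 := by rw [← ha, ← map_add, h4]
    refine ((hM p.1 ?_).mul (hN p.2 ?_)) m
    · by_contra h5
      have h3 : p.2 = 0 := (Finsupp.degree_eq_zero_iff _).1 (by omega)
      rw [h3, add_zero] at h4
      exact h2 (Prod.ext h4 h3)
    · by_contra h5
      have h3 : p.1 = 0 := (Finsupp.degree_eq_zero_iff _).1 (by omega)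
      rw [h3, zero_add] at h4
      exact h1 (Prod.ext h3 h4)

end

noncomputable section

variable {r : ℕ} {ι : Type*} [Fintype ι] [DecidableEq ι]

/-! ## Flat connections and gauge transformations -/

/-- Flatness of the connection `h∂_i + W_i`. -/
def IsFlat (W : Fin r → Matrix ι ι (FKh r)) : Prop :=
  ∀ l i, matD l (W i) + W l * W i = matD i (W l) + W i * W l

/-- `g` transforms the connection `h∂_i + W_i` into `h∂_i + V_i`. -/
def IsGauge (g : Matrix ι ι (FKh r)) (W V : Fin r → Matrix ι ι (FKh r)) : Prop :=
  ∀ i, V i * g = g * W i - matD i g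

theorem matD_one (i : Fin r) : matD i (1 : Matrix ι ι (FKh r)) = 0 := by
  have := matD_mul i (1 : Matrix ι ι (FKh r)) 1
  simpa using this

/-- Multiplied by `g`, each side of the flatness equation for `V` is `g` times the corresponding
side for `W`, up to terms symmetric in `l` and `i`; then the unit `g` is cancelled. -/
theorem IsFlat.of_gauge {g : Matrix ι ι (FKh r)} {W V : Fin r → Matrix ι ι (FKh r)}
    (hg : IsUnit g) (h : IsGauge g W V) (hW : IsFlat W) : IsFlat V := by
  have key : ∀ l i, (matD l (V i) + V l * V i) * g = g * (matD l (W i) + W l * W i) -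
      matD l (matD i g) - (V i * matD l g + V l * matD i g) := by
    intro l i
    have h1 := congrArg (matD l) (h i)
    rw [matD_mul, map_sub, matD_mul] at h1
    have h2 : V l * V i * g = (g * W l - matD l g) * W i - V l * matD i g := by
      rw [mul_assoc, h i, mul_sub, ← mul_assoc, h l]
    rw [add_mul, h2, eq_sub_of_add_eq h1]
    noncomm_ring
  intro l i
  rw [← hg.mul_left_inj, key, key, hW l i, matD_comm l i, add_comm (V i * _)]

theorem IsGauge.trans {g g' : Matrix ι ι (FKh r)} {W V U : Fin r → Matrix ι ι (FKh r)}
    (h : IsGauge g W V) (h' : IsGauge g' V U) : IsGauge (g' * g) W U := by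
  intro i
  rw [← mul_assoc, h' i, matD_mul, sub_mul, mul_assoc, h i]
  noncomm_ring

/-! ## Homogeneity -/

/-- The degree of `q^a`. -/
def qWeight (qdeg : Fin r → ℕ) (a : Fin r →₀ ℕ) : ℕ := ∑ i, qdeg i * a i

theorem qWeight_add (qdeg : Fin r → ℕ) (a b : Fin r →₀ ℕ) :
    qWeight qdeg (a + b) = qWeight qdeg a + qWeight qdeg b := by
  simp [qWeight, mul_add, Finset.sum_add_distrib]

theorem qWeight_zero (qdeg : Fin r → ℕ) : qWeight qdeg 0 = 0 := by
  simp [qWeight]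

theorem mul_degree_le_qWeight {qdeg : Fin r → ℕ} {c : ℕ} (h : ∀ i, c ≤ qdeg i) (a : Fin r →₀ ℕ) :
    c * a.degree ≤ qWeight qdeg a := by
  rw [Finsupp.degree_eq_sum, Finset.mul_sum]
  exact Finset.sum_le_sum fun i _ => Nat.mul_le_mul_right _ (h i)

/-- The matrix `M` is homogeneous of degree `e`, where the `k`-th basis vector has degree
`2 n_k`. -/
def IsGraded (qdeg : Fin r → ℕ) (n : ι → ℕ) (e : ℕ) (M : Matrix ι ι (FKh r)) : Prop :=
  ∀ k j a m, PowerSeries.coeff m (MvPowerSeries.coeff a (M k j)) ≠ 0 →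
    2 * m + qWeight qdeg a + 2 * n k = 2 * n j + e

namespace IsGraded

variable {qdeg : Fin r → ℕ} {n : ι → ℕ} {e e' : ℕ} {M M' : Matrix ι ι (FKh r)}

theorem add (h : IsGraded qdeg n e M) (h' : IsGraded qdeg n e M') :
    IsGraded qdeg n e (M + M') := by
  intro k j a m hne
  by_cases h0 : PowerSeries.coeff m (MvPowerSeries.coeff a (M k j)) = 0
  · refine h' k j a m fun h1 => hne ?_
    rw [Matrix.add_apply, map_add, map_add, h0, h1, add_zero]
  · exact h k j a m h0

theorem neg (h : IsGraded qdeg n e M) : IsGraded qdeg n e (-M) := by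
  intro k j a m hne
  refine h k j a m fun h0 => hne ?_
  rw [Matrix.neg_apply, map_neg, map_neg, h0, neg_zero]

theorem sub (h : IsGraded qdeg n e M) (h' : IsGraded qdeg n e M') :
    IsGraded qdeg n e (M - M') := by
  rw [sub_eq_add_neg]
  exact h.add h'.neg

theorem zero : IsGraded qdeg n e (0 : Matrix ι ι (FKh r)) := by
  intro k j a m hne
  simp at hne

theorem one : IsGraded qdeg n 0 (1 : Matrix ι ι (FKh r)) := by
  classical
  intro k j a m hne
  by_cases hkj : k = j
  · subst hkj
    by_cases ha : a = 0
    · subst ha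
      by_cases hm : m = 0
      · simp [hm, qWeight_zero]
      · simp [MvPowerSeries.coeff_one, PowerSeries.coeff_one, hm] at hne
    · simp [MvPowerSeries.coeff_one, ha] at hne
  · simp [hkj] at hne

theorem sum {α : Type*} {s : Finset α} {M : α → Matrix ι ι (FKh r)}
    (h : ∀ i ∈ s, IsGraded qdeg n e (M i)) : IsGraded qdeg n e (∑ i ∈ s, M i) :=
  Finset.sum_induction _ _ (fun _ _ => add) zero h

theorem mul (h : IsGraded qdeg n e M) (h' : IsGraded qdeg n e' M') :
    IsGraded qdeg n (e + e') (M * M') := by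
  classical
  intro k j a m hne
  simp only [Matrix.mul_apply, map_sum, MvPowerSeries.coeff_mul, PowerSeries.coeff_mul] at hne
  obtain ⟨l, -, hl⟩ := Finset.exists_ne_zero_of_sum_ne_zero hne
  obtain ⟨p, hp, hl⟩ := Finset.exists_ne_zero_of_sum_ne_zero hl
  obtain ⟨t, ht, hl⟩ := Finset.exists_ne_zero_of_sum_ne_zero hl
  have h1 := h k l _ _ (left_ne_zero_of_mul hl)
  have h2 := h' l j _ _ (right_ne_zero_of_mul hl)
  rw [Finset.HasAntidiagonal.mem_antidiagonal] at hp ht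
  rw [← hp, ← ht, qWeight_add]
  omega

theorem pow (h : IsGraded qdeg n 0 M) (p : ℕ) : IsGraded qdeg n 0 (M ^ p) := by
  induction p with
  | zero => simpa using one
  | succ p ih => rw [pow_succ]; exact ih.mul h

theorem matD (h : IsGraded qdeg n e M) (i : Fin r) : IsGraded qdeg n (e + 2) (matD i M) := by
  intro k j a m hne
  have h1 := qCoeff_matD i M a
  cases m with
  | zero =>
    refine absurd ?_ hne
    exact (congrFun (congrFun ((congrArg (hCoeff 0) h1).trans (hCoeff_zero_smul _ _)) k) j)
  | succ m =>
    have h2 := congrFun (congrFun ((congrArg (hCoeff (m + 1)) h1).trans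
      (hCoeff_succ_smul _ _ _)) k) j
    have h3 := h k j a m fun h0 => hne (h2.trans (by
      rw [Matrix.smul_apply, hCoeff_apply, qCoeff_apply, h0, smul_zero]))
    omega

/-- Away from `q^0` the degree in `q` is positive, and in total degree 0 this has to be paid for by
a drop from `n j` to `n k`. -/
theorem strictlyTriangular (hq : ∀ i, 0 < qdeg i) (h : IsGraded qdeg n 0 M)
    (h1 : qCoeff 0 M = 1) (k j : ι) (hne : (M - 1) k j ≠ 0) : n k < n j := by
  obtain ⟨a, ha⟩ : ∃ a, MvPowerSeries.coeff a ((M - 1) k j) ≠ 0 := by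
    by_contra! h0
    exact hne (MvPowerSeries.ext h0)
  obtain ⟨m, hm⟩ : ∃ m, PowerSeries.coeff m (MvPowerSeries.coeff a ((M - 1) k j)) ≠ 0 := by
    by_contra! h0
    exact ha (PowerSeries.ext h0)
  have ha0 : a ≠ 0 := by
    rintro rfl
    refine ha ?_
    rw [← qCoeff_apply, map_sub, h1, qCoeff_one, if_pos rfl, sub_self]
    rfl
  have h2 := (h.sub one) k j a m hm
  have h3 : 0 < a.degree := by
    rw [Nat.pos_iff_ne_zero, Ne, Finsupp.degree_eq_zero_iff]
    exact ha0
  have h4 := mul_degree_le_qWeight (c := 1) hq a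
  omega

/-- The inverse is a finite geometric series in the nilpotent matrix `1 - M`, hence again
homogeneous of degree 0. -/
theorem exists_inverse (hq : ∀ i, 0 < qdeg i) (h : IsGraded qdeg n 0 M)
    (h1 : qCoeff 0 M = 1) : ∃ M', M * M' = 1 ∧ M' * M = 1 ∧ IsGraded qdeg n 0 M' := by
  obtain ⟨p, hp⟩ := isNilpotent_of_strictlyTriangular (h.strictlyTriangular hq h1)
  have hp' : (1 - M) ^ p = 0 := by rw [← neg_sub, neg_pow, hp, mul_zero]
  have h2 : M * ∑ i ∈ Finset.range p, (1 - M) ^ i = 1 := by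
    have := mul_neg_geom_sum (1 - M) p
    rwa [hp', sub_sub_cancel, sub_zero] at this
  exact ⟨_, h2, mul_eq_one_comm.1 h2, sum fun i _ => (one.sub h).pow i⟩

end IsGraded

/-! ## Existence of the normalizing gauge transformation -/

theorem weight_eq_of_isGraded {qdeg : Fin r → ℕ} {n : ι → ℕ} {e : ℕ}
    {M : Matrix ι ι (FKh r)} (h : IsGraded qdeg n e M) (k j : ι)
    (hne : hCoeff 0 (qCoeff 0 M) k j ≠ 0) : 2 * n k = 2 * n j + e := by
  have := h k j 0 0 hne
  rw [qWeight_zero] at this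
  omega

theorem isNilpotent_of_isGraded {qdeg : Fin r → ℕ} {n : ι → ℕ} {M : Matrix ι ι (FKh r)}
    (h : IsGraded qdeg n 2 M) : IsNilpotent (hCoeff 0 (qCoeff 0 M)) :=
  isNilpotent_of_strictlyLowerTriangular (n := n) fun k j hne => by
    have := weight_eq_of_isGraded h k j hne
    omega

/-- Matrices whose `(k, j)` entry vanishes unless `c + 2 n_k = 2 n_j + e`. -/
def gradedMat (n : ι → ℕ) (c e : ℕ) : Submodule ℂ (Matrix ι ι ℂ) where
  carrier := {Y | ∀ k j, Y k j ≠ 0 → c + 2 * n k = 2 * n j + e}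
  zero_mem' := fun k j h => absurd rfl h
  add_mem' := fun {Y Z} hY hZ k j h => by
    by_cases h0 : Y k j = 0
    · refine hZ k j fun h1 => h ?_
      rw [Matrix.add_apply, h0, h1, add_zero]
    · exact hY k j h0
  smul_mem' := fun c Y hY k j h => hY k j (right_ne_zero_of_mul h)

theorem adMat_mem_gradedMat {n : ι → ℕ} {w : Matrix ι ι ℂ}
    (hw : ∀ k j, w k j ≠ 0 → 2 * n k = 2 * n j + 2) {c e : ℕ} {Y : Matrix ι ι ℂ}
    (hY : Y ∈ gradedMat n (c + 2) e) : adMat w Y ∈ gradedMat n c e := by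
  rw [adMat_apply]
  refine Submodule.sub_mem _ (fun k j h => ?_) (fun k j h => ?_) <;>
  · rw [Matrix.mul_apply] at h
    obtain ⟨l, -, hl⟩ := Finset.exists_ne_zero_of_sum_ne_zero h
    first
    | have h1 := hw _ _ (left_ne_zero_of_mul hl)
      have h2 := hY _ _ (right_ne_zero_of_mul hl)
      omega
    | have h1 := hY _ _ (left_ne_zero_of_mul hl)
      have h2 := hw _ _ (right_ne_zero_of_mul hl)
      omega

/-- A matrix of power series with prescribed coefficients. -/
def matOfCoeff (x : (Fin r →₀ ℕ) → ℕ → Matrix ι ι ℂ) : Matrix ι ι (FKh r) :=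
  Matrix.of fun k j a => PowerSeries.mk fun m => x a m k j

theorem hCoeff_qCoeff_matOfCoeff (x : (Fin r →₀ ℕ) → ℕ → Matrix ι ι ℂ) (a : Fin r →₀ ℕ) (m : ℕ) :
    hCoeff m (qCoeff a (matOfCoeff x)) = x a m := by
  ext k j : 1
  change PowerSeries.coeff m (PowerSeries.mk fun m => x a m k j) = _
  rw [PowerSeries.coeff_mk]

theorem qCoeff_gauge_add_one {X : Matrix ι ι (FKh r)} {W V : Fin r → Matrix ι ι (FKh r)}
    (h : IsGauge (1 + X) W V) (i : Fin r) (a : Fin r →₀ ℕ) :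
    qCoeff a (V i) + qCoeff a (V i * X) = qCoeff a (W i) + qCoeff a (X * W i) -
      (PowerSeries.X * (a i : PowerSeries ℂ)) • qCoeff a X := by
  have h1 := congrArg (qCoeff a) (h i)
  rw [mul_add, mul_one, add_mul, one_mul, map_add (matD i), matD_one, zero_add] at h1
  rwa [map_add, map_sub, map_add, qCoeff_matD] at h1

/-- One step of the construction: the coefficients of `q^a` with `|a| = n + 1` are made independent
of `h`. -/
theorem exists_gauge_step {qdeg : Fin r → ℕ} (hq : ∀ i, 0 < qdeg i) {n : ι → ℕ}
    {W : Fin r → Matrix ι ι (FKh r)} (hflat : IsFlat W) (hgr : ∀ i, IsGraded qdeg n 2 (W i))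
    {N : ℕ} (hc : ∀ i, HConstUpTo N (W i)) :
    ∃ (g : Matrix ι ι (FKh r)) (V : Fin r → Matrix ι ι (FKh r)), IsGraded qdeg n 0 g ∧
      qCoeff 0 g = 1 ∧ IsGauge g W V ∧ IsFlat V ∧ (∀ i, IsGraded qdeg n 2 (V i)) ∧
      ∀ i, HConstUpTo (N + 1) (V i) := by
  classical
  set w : Fin r → Matrix ι ι ℂ := fun i => hCoeff 0 (qCoeff 0 (W i)) with hw
  have hwE : ∑ i, w i = hCoeff 0 (qCoeff 0 (∑ i, W i)) := by simp [hw]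
  have hgrE : IsGraded qdeg n 2 (∑ i, W i) := IsGraded.sum fun i _ => hgr i
  have hnil := isNilpotent_adMat (isNilpotent_of_isGraded hgrE)
  rw [← hwE] at hnil
  have hN : ((N + 1 : ℕ) : ℂ) ≠ 0 := Nat.cast_ne_zero.2 (Nat.succ_ne_zero N)
  obtain ⟨p, hp⟩ := id hnil
  -- The correction cancels the coefficient of `h^(m+1)` in the sum of all components; the shift by
  -- one is the factor `h` in `h∂_i`.
  set y : (Fin r →₀ ℕ) → ℕ → Matrix ι ι ℂ := fun a => recurrenceSol (adMat (∑ i, w i)) p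
    ((N + 1 : ℕ) : ℂ) fun m => hCoeff (m + 1) (qCoeff a (∑ i, W i)) with hy
  set x : (Fin r →₀ ℕ) → ℕ → Matrix ι ι ℂ := fun a m => if a.degree = N + 1 then y a m else 0
    with hx
  set X : Matrix ι ι (FKh r) := matOfCoeff x with hX
  have hXa : ∀ a, a.degree ≠ N + 1 → qCoeff a X = 0 := fun a ha => ext_hCoeff fun m => by
    rw [hX, hCoeff_qCoeff_matOfCoeff, map_zero, hx]
    simp [ha]
  have hXlow : ∀ a : Fin r →₀ ℕ, a.degree ≤ N → qCoeff a X = 0 := fun a ha => hXa a (by omega)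
  have hXgr : IsGraded qdeg n 0 X := by
    intro k j a m hne
    have h1 : x a m k j ≠ 0 := by rwa [← hCoeff_qCoeff_matOfCoeff x a m]
    by_cases ha : a.degree = N + 1
    · have h2 : x a m = y a m := if_pos ha
      -- The source term at index `m` is the coefficient of `h^(m+1)` of a matrix of degree 2, so
      -- the solution has degree 0 as the coefficient of `h^m`.
      have h3 : y a m ∈ gradedMat n (2 * (m + 1) + qWeight qdeg a) 2 := by
        refine recurrenceSol_mem (S := fun m => gradedMat n (2 * (m + 1) + qWeight qdeg a) 2)
          (fun m v hv => adMat_mem_gradedMat (fun k j h => ?_) ?_) _ _ (fun m k j h => ?_) m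
        · rw [hwE] at h
          exact weight_eq_of_isGraded hgrE k j h
        · convert hv using 2
          ring
        · exact hgrE k j a (m + 1) h
      have := h3 k j (h2 ▸ h1)
      omega
    · exact absurd (congrFun (congrFun (if_neg ha : x a m = 0) k) j) h1
  have hggr : IsGraded qdeg n 0 (1 + X) := IsGraded.one.add hXgr
  have hg0 : qCoeff 0 (1 + X) = 1 := by
    rw [map_add, qCoeff_one, if_pos rfl, hXlow 0 (by simp), add_zero]
  obtain ⟨g', hgg', hg'g, hg'gr⟩ := hggr.exists_inverse hq hg0
  set V : Fin r → Matrix ι ι (FKh r) := fun i => ((1 + X) * W i - matD i (1 + X)) * g' with hV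
  have hgauge : IsGauge (1 + X) W V := fun i => by
    rw [hV]
    simp only
    rw [mul_assoc, hg'g, mul_one]
  have hVflat : IsFlat V := hflat.of_gauge ⟨⟨_, g', hgg', hg'g⟩, rfl⟩ hgauge
  have hVgr : ∀ i, IsGraded qdeg n 2 (V i) := fun i => by
    have h1 : IsGraded qdeg n (0 + 2) ((1 + X) * W i) := hggr.mul (hgr i)
    exact (h1.sub (hggr.matD i)).mul hg'gr
  have hlow : ∀ i, ∀ a : Fin r →₀ ℕ, a.degree ≤ N → qCoeff a (V i) = qCoeff a (W i) := by
    intro i a ha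
    have := qCoeff_gauge_add_one hgauge i a
    rwa [(qCoeff_mul_eq_zero hXlow a ha).1, (qCoeff_mul_eq_zero hXlow a ha).2, hXlow a ha,
      smul_zero, sub_zero, add_zero, add_zero] at this
  have hVc : ∀ i, HConstUpTo N (V i) := fun i a ha => by rw [hlow i a ha]; exact hc i a ha
  have hV0 : ∀ i, qCoeff 0 (V i) = qCoeff 0 (W i) := fun i => hlow i 0 (by simp)
  -- In the lowest degree of `X` the gauge action is linear: a derivative plus a commutator with the
  -- constant term.
  have hstep : ∀ i a m, a.degree = N + 1 → hCoeff (m + 1) (qCoeff a (V i)) =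
      hCoeff (m + 1) (qCoeff a (W i)) - ((a i : ℂ) • y a m + adMat (w i) (y a (m + 1))) := by
    intro i a m ha
    have h1 := congrArg (hCoeff (m + 1)) (qCoeff_gauge_add_one hgauge i a)
    have h2 : ∀ m, hCoeff m (qCoeff a X) = y a m := fun m => by
      rw [hX, hCoeff_qCoeff_matOfCoeff, hx]
      simp [ha]
    rw [(qCoeff_mul_low hXlow a ha).1, (qCoeff_mul_low hXlow a ha).2, map_add, map_sub, map_add,
      hCoeff_succ_smul, hV0, (hc i 0 (by simp)).hCoeff_mul,
      (hc i 0 (by simp)).hCoeff_mul_right, h2, h2] at h1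
    rw [adMat_apply, eq_sub_of_add_eq h1]
    abel
  -- Summing over `i` turns the `a i` into `N + 1` and gives the equation that `y` solves.
  have hE : ∀ a m, a.degree = N + 1 → hCoeff (m + 1) (qCoeff a (∑ i, V i)) = 0 := by
    intro a m ha
    have h1 : ∑ i, ((a i : ℂ) • y a m + adMat (w i) (y a (m + 1))) =
        hCoeff (m + 1) (qCoeff a (∑ i, W i)) := by
      have h0 : ((N + 1 : ℕ) : ℂ) • y a m + adMat (∑ i, w i) (y a (m + 1)) =
        hCoeff (m + 1) (qCoeff a (∑ i, W i)) := recurrenceSol_spec hp hN _ m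
      have hd : ((N + 1 : ℕ) : ℂ) = ∑ i, (a i : ℂ) := by
        rw [← ha, Finsupp.degree_eq_sum, Nat.cast_sum]
      rw [← h0, hd, Finset.sum_add_distrib, ← Finset.sum_smul]
      simp only [adMat_apply, Finset.sum_mul, Finset.mul_sum, Finset.sum_sub_distrib]
    rw [map_sum, map_sum, Finset.sum_congr rfl fun i _ => hstep i a m ha, Finset.sum_sub_distrib,
      h1, map_sum, map_sum, sub_self]
  refine ⟨1 + X, V, hggr, hg0, hgauge, hVflat, hVgr, fun i a ha => ?_⟩
  rcases Nat.lt_or_eq_of_le ha with ha | ha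
  · exact hVc i a (by omega)
  have hVE : HConstUpTo N (∑ l, V l) := fun a ha => by
    rw [map_sum]
    exact HConst.sum fun l _ => hVc l a ha
  -- Flatness of each `V i` against the sum of all components, from which `h` has just been removed.
  have hsum : (∑ l, matD l (V i)) + (∑ l, V l) * V i = matD i (∑ l, V l) + V i * ∑ l, V l := by
    rw [Finset.sum_mul, Finset.mul_sum, map_sum, ← Finset.sum_add_distrib,
      ← Finset.sum_add_distrib]
    exact Finset.sum_congr rfl fun l _ => hVflat l i
  have hV0E : hCoeff 0 (qCoeff 0 (∑ l, V l)) = ∑ l, w l := by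
    simp only [map_sum, hV0, hw]
  -- The condition `1 ≤ m` is needed because the derivative of the sum contributes its coefficient
  -- of `h^m`, which is known to vanish only for positive `m`.
  have hrec : ∀ m, 1 ≤ m → ((N + 1 : ℕ) : ℂ) • hCoeff m (qCoeff a (V i)) +
      adMat (∑ l, w l) (hCoeff (m + 1) (qCoeff a (V i))) = 0 := by
    intro m hm
    obtain ⟨m, rfl⟩ := Nat.exists_eq_add_of_le' hm
    have h1 := congrArg (fun M => hCoeff (m + 1 + 1) (qCoeff a M)) hsum
    simp only [map_add (qCoeff a), map_add (hCoeff (m + 1 + 1)),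
      map_sum (qCoeff a) (fun l => matD l (V i)), qCoeff_matD, hCoeff_succ_smul] at h1
    rw [sum_smul_qCoeff, hCoeff_succ_smul, hVE.hCoeff_qCoeff_mul (hVc i) a ha,
      (hVc i).hCoeff_qCoeff_mul hVE a ha, hE a _ ha, hE a _ ha, hV0E, zero_mul, add_zero,
      smul_zero, mul_zero, zero_add, zero_add, ha] at h1
    rw [adMat_apply, ← add_sub_assoc, h1, sub_self]
  intro m
  exact eq_zero_of_recurrence hnil hN hrec (m + 1) (by omega)

theorem exists_gauge_upTo {qdeg : Fin r → ℕ} (hq : ∀ i, 0 < qdeg i) {n : ι → ℕ}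
    {W : Fin r → Matrix ι ι (FKh r)} (hflat : IsFlat W) (hgr : ∀ i, IsGraded qdeg n 2 (W i))
    (hc : ∀ i, HConstUpTo 0 (W i)) (N : ℕ) :
    ∃ (g : Matrix ι ι (FKh r)) (V : Fin r → Matrix ι ι (FKh r)), IsGraded qdeg n 0 g ∧
      qCoeff 0 g = 1 ∧ IsGauge g W V ∧ IsFlat V ∧ (∀ i, IsGraded qdeg n 2 (V i)) ∧
      ∀ i, HConstUpTo N (V i) := by
  induction N with
  | zero =>
    refine ⟨1, W, IsGraded.one, by rw [qCoeff_one, if_pos rfl], fun i => ?_, hflat, hgr, hc⟩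
    rw [matD_one, mul_one, one_mul, sub_zero]
  | succ N ih =>
    obtain ⟨g, V, hg, hg0, hgV, hV, hVgr, hVc⟩ := ih
    obtain ⟨g', U, hg', hg0', hgU, hU, hUgr, hUc⟩ := exists_gauge_step hq hV hVgr hVc
    refine ⟨g' * g, U, hg'.mul hg, ?_, hgV.trans hgU, hU, hUgr, hUc⟩
    rw [qCoeff_mul_zero, hg0, hg0', one_mul]

theorem exists_gauge {qdeg : Fin r → ℕ} (hq : ∀ i, 0 < qdeg i) {n : ι → ℕ}
    {W : Fin r → Matrix ι ι (FKh r)} (hflat : IsFlat W) (hgr : ∀ i, IsGraded qdeg n 2 (W i))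
    (hc : ∀ i, HConst (qCoeff 0 (W i))) :
    ∃ (g : Matrix ι ι (FKh r)) (V : Fin r → Matrix ι ι (FKh r)), IsGraded qdeg n 0 g ∧
      qCoeff 0 g = 1 ∧ IsGauge g W V ∧ ∀ i a, HConst (qCoeff a (V i)) := by
  have hc' : ∀ i, HConstUpTo 0 (W i) := fun i a ha => by
    rw [(Finsupp.degree_eq_zero_iff a).1 (by omega)]
    exact hc i
  obtain ⟨g, V, hg, hg0, hgV, -, hVgr, hVc⟩ :=
    -- Degree 2 forces `|a| ≤ 2 n_j + 2` wherever a coefficient is nonzero, so beyond this bound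
    -- nothing remains to be removed and no infinite product of gauges arises.
    exists_gauge_upTo hq hflat hgr hc' (2 * (∑ j, n j) + 2)
  refine ⟨g, V, hg, hg0, hgV, fun i a => ?_⟩
  by_cases ha : a.degree ≤ 2 * (∑ j, n j) + 2
  · exact hVc i a ha
  intro m
  ext k j
  by_contra hne
  have h1 := hVgr i k j a (m + 1) hne
  have h2 := mul_degree_le_qWeight (c := 1) hq a
  have h3 : n j ≤ ∑ j, n j := Finset.single_le_sum (fun _ _ => Nat.zero_le _) (Finset.mem_univ j)
  omega

/-! ## Uniqueness -/

/-- The targets `V` and `V'` may differ. In the lowest degree of the difference `Δ = g - g'`, the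
unknown difference of targets is free of `h`, so it drops out of the coefficients of `h^(m+1)` and
leaves the homogeneous recurrence for `Δ`. -/
theorem gauge_unique {W V V' : Fin r → Matrix ι ι (FKh r)} {g g' : Matrix ι ι (FKh r)}
    (hnil : IsNilpotent (hCoeff 0 (qCoeff 0 (∑ i, W i)))) (hg0 : qCoeff 0 g = 1)
    (hg0' : qCoeff 0 g' = 1) (hg : IsGauge g W V) (hg' : IsGauge g' W V')
    (hV : ∀ i a, HConst (qCoeff a (V i))) (hV' : ∀ i a, HConst (qCoeff a (V' i))) : g = g' := by
  have hz : ∀ (g : Matrix ι ι (FKh r)) (V : Fin r → Matrix ι ι (FKh r)), qCoeff 0 g = 1 →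
      IsGauge g W V → qCoeff 0 (∑ i, V i) = qCoeff 0 (∑ i, W i) := by
    intro g V h1 h2
    rw [map_sum, map_sum]
    refine Finset.sum_congr rfl fun i _ => ?_
    have := congrArg (qCoeff 0) (h2 i)
    rw [map_sub, qCoeff_mul_zero, qCoeff_mul_zero, h1, qCoeff_matD, h1] at this
    simpa using this
  have hs : ∀ (g : Matrix ι ι (FKh r)) (V : Fin r → Matrix ι ι (FKh r)), IsGauge g W V →
      (∑ i, V i) * g = g * (∑ i, W i) - ∑ i, matD i g := by
    intro g V h
    rw [Finset.sum_mul, Finset.mul_sum, ← Finset.sum_sub_distrib]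
    exact Finset.sum_congr rfl fun i _ => h i
  set Δ := g - g' with hΔ
  set U := ∑ i, V i - ∑ i, V' i with hU
  have heq : U * g + (∑ i, V' i) * Δ = Δ * (∑ i, W i) - ∑ i, matD i Δ := by
    have h1 := hs g V hg
    have h2 := hs g' V' hg'
    have h3 : ∑ i, matD i Δ = ∑ i, matD i g - ∑ i, matD i g' := by
      simp [hΔ]
    rw [hU, h3, sub_mul, h1, hΔ, mul_sub, h2, sub_mul]
    abel
  have hUc : ∀ a, HConst (qCoeff a U) := fun a m => by
    rw [hU, map_sub, map_sub, map_sum (qCoeff a) V, map_sum (qCoeff a) V',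
      HConst.sum (fun i _ => hV i a) m, HConst.sum (fun i _ => hV' i a) m, sub_zero]
  have hc0 : HConst (qCoeff 0 (∑ i, W i)) := by
    rw [← hz g V hg0 hg, map_sum]
    exact HConst.sum fun i _ => hV i 0
  have key : ∀ N, ∀ a : Fin r →₀ ℕ, a.degree ≤ N → qCoeff a Δ = 0 ∧ qCoeff a U = 0 := by
    intro N
    induction N with
    | zero =>
      intro a ha
      rw [(Finsupp.degree_eq_zero_iff a).1 (by omega), hΔ, hU, map_sub, map_sub, hg0, hg0',
        hz g V hg0 hg, hz g' V' hg0' hg']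
      simp
    | succ N ih =>
      intro a ha
      rcases Nat.lt_or_eq_of_le ha with ha | ha
      · exact ih a (by omega)
      have h1 := congrArg (qCoeff a) heq
      rw [map_add, map_sub, (qCoeff_mul_low (fun b hb => (ih b hb).2) a ha).2,
        (qCoeff_mul_low (fun b hb => (ih b hb).1) a ha).1,
        (qCoeff_mul_low (fun b hb => (ih b hb).1) a ha).2, hg0, mul_one, hz g' V' hg0' hg',
        map_sum (qCoeff a) (fun i => matD i Δ)] at h1
      simp only [qCoeff_matD] at h1
      rw [sum_smul_qCoeff, ha] at h1
      have hN : ((N + 1 : ℕ) : ℂ) ≠ 0 := Nat.cast_ne_zero.2 (Nat.succ_ne_zero N)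
      have hΔ0 : qCoeff a Δ = 0 := by
        refine ext_hCoeff fun m => ?_
        rw [map_zero]
        refine eq_zero_of_recurrence (x := fun m => hCoeff m (qCoeff a Δ)) (m₀ := 0)
          (isNilpotent_adMat hnil) hN (fun m _ => ?_) m (Nat.zero_le _)
        have h2 := congrArg (hCoeff (m + 1)) h1
        rw [map_add _ (qCoeff a U), map_sub _ (qCoeff a Δ * _), hUc a m, hCoeff_succ_smul, hc0.hCoeff_mul, hc0.hCoeff_mul_right,
          zero_add] at h2
        rw [adMat_apply, h2]
        abel
      refine ⟨hΔ0, ?_⟩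
      -- With `Δ` gone in this degree, the equation reduces to the vanishing of `U`, which keeps the
      -- induction going.
      rw [hΔ0] at h1
      simpa using h1
  rw [← sub_eq_zero]
  exact ext_qCoeff fun a => by rw [map_zero]; exact (key _ a le_rfl).1

end

noncomputable section

variable {r u s : ℕ}

/-! ## The ring `D^h` -/

theorem hEuler_monomial (i : Fin r) (a : Fin r →₀ ℕ) (c : Polynomial ℂ) :
    hEuler i (MvPolynomial.monomial a c) =
      ((Polynomial.X : Polynomial ℂ) * (a i : Polynomial ℂ)) • MvPolynomial.monomial a c := by
  change MvPolynomial.C Polynomial.X * MvPolynomial.X i *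
    MvPolynomial.pderiv i (MvPolynomial.monomial a c) = _
  rw [MvPolynomial.pderiv_monomial, MvPolynomial.smul_monomial, mul_assoc, MvPolynomial.X,
    MvPolynomial.monomial_mul, MvPolynomial.C_mul_monomial]
  by_cases h : a i = 0
  · simp [h]
  · have : Finsupp.single i 1 + (a - Finsupp.single i 1) = a :=
      add_tsub_cancel_of_le (Finsupp.single_le_iff.2 (Nat.one_le_iff_ne_zero.2 h))
    rw [this, smul_eq_mul, one_mul]
    congr 1
    ring

theorem coeff_hEuler (i : Fin r) (f : Kh r) (a : Fin r →₀ ℕ) :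
    (hEuler i f).coeff a = (Polynomial.X : Polynomial ℂ) * (a i : Polynomial ℂ) * f.coeff a := by
  classical
  induction f using MvPolynomial.induction_on' with
  | monomial b c =>
    rw [hEuler_monomial, MvPolynomial.coeff_smul, MvPolynomial.coeff_monomial, smul_eq_mul]
    split_ifs with h
    · rw [h]
    · simp
  | add p q hp hq => rw [map_add, MvPolynomial.coeff_add, hp, hq, MvPolynomial.coeff_add, mul_add]

theorem hEuler_mul (i : Fin r) (f g : Kh r) :
    hEuler i (f * g) = hEuler i f * g + f * hEuler i g := by
  change _ * MvPolynomial.pderiv i (f * g) = _ * MvPolynomial.pderiv i f * g +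
    f * (_ * MvPolynomial.pderiv i g)
  rw [Derivation.leibniz, smul_eq_mul, smul_eq_mul]
  ring

theorem Dh_ext {P Q : Dh r} (h : ∀ a, (P : Module.End (Polynomial ℂ) (Kh r))
    (MvPolynomial.monomial a 1) = (Q : Module.End (Polynomial ℂ) (Kh r))
    (MvPolynomial.monomial a 1)) : P = Q := by
  refine Subtype.ext (MvPolynomial.linearMap_ext fun a => LinearMap.ext_ring ?_)
  exact h a

theorem hD_mul_coeffD (i : Fin r) (f : Kh r) :
    hD i * coeffD r f = coeffD r f * hD i + coeffD r (hEuler i f) := by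
  refine Subtype.ext (LinearMap.ext fun g => ?_)
  change hEuler i (f * g) = f * hEuler i g + hEuler i f * g
  rw [hEuler_mul, add_comm]

theorem hD_comm (i l : Fin r) : hD i * hD l = hD l * hD i := by
  refine Dh_ext fun a => ?_
  change hEuler i (hEuler l (MvPolynomial.monomial a 1)) =
    hEuler l (hEuler i (MvPolynomial.monomial a 1))
  rw [hEuler_monomial, hEuler_monomial, map_smul, map_smul, hEuler_monomial, hEuler_monomial,
    smul_comm]

theorem list_ofFn_prod_apply {R V : Type*} [CommRing R] [AddCommGroup V] [Module R V] (v : V)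
    (m : ℕ) (f : Fin m → Module.End R V) (c : Fin m → R) (h : ∀ i, f i v = c i • v) :
    (List.ofFn f).prod v = (∏ i, c i) • v := by
  induction m with
  | zero => simp
  | succ m ih =>
    rw [List.ofFn_succ, List.prod_cons, Module.End.mul_apply,
      ih (fun i => f i.succ) (fun i => c i.succ) (fun i => h _), map_smul, h, smul_smul,
      Fin.prod_univ_succ, mul_comm]

theorem monD_apply (I a : Fin r →₀ ℕ) :
    (monD I : Module.End (Polynomial ℂ) (Kh r)) (MvPolynomial.monomial a 1) =
      (∏ i, ((Polynomial.X : Polynomial ℂ) * (a i : Polynomial ℂ)) ^ I i) •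
        MvPolynomial.monomial a 1 := by
  have h1 : (monD I : Module.End (Polynomial ℂ) (Kh r)) =
      (List.ofFn fun i => hEuler i ^ I i).prod := by
    change (Dh r).subtype (monD I) = _
    rw [monD, map_list_prod, List.map_ofFn]
    rfl
  rw [h1]
  refine list_ofFn_prod_apply _ _ _ _ fun i => ?_
  generalize I i = k
  induction k with
  | zero => simp
  | succ k ih =>
    rw [pow_succ', Module.End.mul_apply, ih, map_smul, hEuler_monomial, smul_smul, pow_succ]

theorem monD_zero : monD (0 : Fin r →₀ ℕ) = 1 := by
  refine Dh_ext fun a => ?_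
  rw [monD_apply]
  simp

theorem monD_add (I J : Fin r →₀ ℕ) : monD (I + J) = monD I * monD J := by
  refine Dh_ext fun a => ?_
  change _ = (monD I : Module.End (Polynomial ℂ) (Kh r)) 
    ((monD J : Module.End (Polynomial ℂ) (Kh r)) _)
  rw [monD_apply, monD_apply, map_smul, monD_apply, smul_smul, ← Finset.prod_mul_distrib]
  congr 1
  refine Finset.prod_congr rfl fun i _ => ?_
  rw [Finsupp.add_apply, pow_add, mul_comm]

theorem monD_single (i : Fin r) : monD (Finsupp.single i 1) = hD i := by
  classical
  refine Dh_ext fun a => ?_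
  change _ = hEuler i _
  rw [monD_apply, hEuler_monomial, Finset.prod_eq_single i]
  · simp
  · intro l _ hl
    simp [hl.symm]
  · simp

/-! ### Full symbols and operators -/

/-- The value at `b = h a` of the full symbol describes the action of an operator on `q^a`. -/
theorem op_apply (f : MvPolynomial (Fin r) (Kh r)) (a : Fin r →₀ ℕ) :
    (op f : Module.End (Polynomial ℂ) (Kh r)) (MvPolynomial.monomial a 1) =
      MvPolynomial.eval (fun i => MvPolynomial.C
        ((Polynomial.X : Polynomial ℂ) * (a i : Polynomial ℂ))) f * MvPolynomial.monomial a 1 := by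
  change (Dh r).subtype (op f) _ = _
  rw [op, map_sum, LinearMap.sum_apply, MvPolynomial.eval_eq', Finset.sum_mul]
  refine Finset.sum_congr rfl fun I _ => ?_
  change f.coeff I * (monD I : Module.End (Polynomial ℂ) (Kh r)) (MvPolynomial.monomial a 1) = _
  rw [monD_apply, MvPolynomial.smul_eq_C_mul, map_prod, mul_assoc]
  simp only [map_pow]

theorem op_add (f g : MvPolynomial (Fin r) (Kh r)) : op (f + g) = op f + op g := by
  refine Dh_ext fun a => ?_
  change _ = (op f : Module.End (Polynomial ℂ) (Kh r)) _ +
    (op g : Module.End (Polynomial ℂ) (Kh r)) _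
  rw [op_apply, op_apply, op_apply, map_add, add_mul]

theorem op_C_mul (c : Kh r) (f : MvPolynomial (Fin r) (Kh r)) :
    op (MvPolynomial.C c * f) = coeffD r c * op f := by
  refine Dh_ext fun a => ?_
  change _ = c * (op f : Module.End (Polynomial ℂ) (Kh r)) _
  rw [op_apply, op_apply, map_mul, MvPolynomial.eval_C, mul_assoc]

theorem op_monomial (I : Fin r →₀ ℕ) (c : Kh r) :
    op (MvPolynomial.monomial I c) = coeffD r c * monD I := by
  refine Dh_ext fun a => ?_
  change _ = c * (monD I : Module.End (Polynomial ℂ) (Kh r)) _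
  rw [op_apply, monD_apply, MvPolynomial.eval_monomial, MvPolynomial.smul_eq_C_mul, mul_assoc,
    map_prod, Finsupp.prod_fintype _ _ (by simp)]
  simp only [map_pow]

theorem op_one : op (1 : MvPolynomial (Fin r) (Kh r)) = 1 := by
  rw [← MvPolynomial.C_1, ← MvPolynomial.monomial_zero', op_monomial, monD_zero, map_one, mul_one]

/-- The action on the monomials `q^a` determines the symbol at all points `b = h a`, and this is a
grid with infinite sides in the domain `K[h]`. -/
theorem op_injective : Function.Injective (op (r := r)) := by
  intro f g hfg
  refine MvPolynomial.funext_set (fun _ => Set.range fun m : ℕ => MvPolynomial.C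
    ((Polynomial.X : Polynomial ℂ) * (m : Polynomial ℂ))) (fun i => ?_) fun x hx => ?_
  · refine Set.infinite_range_of_injective fun m m' h => ?_
    have h1 := mul_left_cancel₀ Polynomial.X_ne_zero (MvPolynomial.C_injective _ _ h)
    exact_mod_cast h1
  · choose a ha using fun i => hx i (Set.mem_univ i)
    have h1 := op_apply f (Finsupp.equivFunOnFinite.symm a)
    rw [hfg, op_apply] at h1
    have h2 := mul_right_cancel₀ (by simp [MvPolynomial.monomial_eq_zero]) h1
    have h3 : x = fun i => MvPolynomial.C ((Polynomial.X : Polynomial ℂ) *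
      (Finsupp.equivFunOnFinite.symm a i : Polynomial ℂ)) := funext fun i => (ha i).symm
    rw [h3]
    exact h2.symm

/-! ### Symbols in the limit `h → 0` -/

theorem hD_mul_op (i : Fin r) (f : MvPolynomial (Fin r) (Kh r)) :
    ∃ g, hD i * op f = op g ∧ MvPolynomial.map (hZero r) g =
      MvPolynomial.X i * MvPolynomial.map (hZero r) f := by
  induction f using MvPolynomial.induction_on' with
  | monomial I c =>
    refine ⟨MvPolynomial.monomial (Finsupp.single i 1 + I) c +
      MvPolynomial.monomial I (hEuler i c), ?_, ?_⟩
    · rw [op_add, op_monomial, op_monomial, op_monomial, ← mul_assoc, hD_mul_coeffD, monD_add,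
        monD_single, add_mul, mul_assoc]
    -- Moving `h∂_i` past a coefficient costs a term divisible by `h`, which is why symbols multiply
    -- in the limit.
    · have h0 : hZero r (hEuler i c) = 0 := by
        change hZero r (MvPolynomial.C Polynomial.X * MvPolynomial.X i * _) = 0
        rw [map_mul, map_mul, hZero, MvPolynomial.map_C, Polynomial.constantCoeff_apply,
          Polynomial.coeff_X_zero, map_zero, zero_mul, zero_mul]
      rw [map_add, MvPolynomial.map_monomial, MvPolynomial.map_monomial, h0, map_zero, add_zero,
        MvPolynomial.map_monomial, MvPolynomial.X, MvPolynomial.monomial_mul, one_mul]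
  | add p q hp hq =>
    obtain ⟨g, hg, hg'⟩ := hp
    obtain ⟨k, hk, hk'⟩ := hq
    exact ⟨g + k, by rw [op_add, op_add, mul_add, hg, hk],
      by rw [map_add, map_add, hg', hk', mul_add]⟩

/-- Quantifying over all `f` makes the property stable under products, so induction on the
generators applies. The case `f = 1` gives surjectivity of `op`; the general case gives
multiplicativity of the limit symbol. -/
theorem exists_symbol (P : Dh r) : ∃ p : MvPolynomial (Fin r) (K r),
    ∀ f, ∃ g, P * op f = op g ∧ MvPolynomial.map (hZero r) g = p * MvPolynomial.map (hZero r) f := by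
  obtain ⟨P, hP⟩ := P
  induction hP using Subring.closure_induction with
  | mem x hx =>
    rcases hx with ⟨c, rfl⟩ | ⟨i, rfl⟩
    · refine ⟨MvPolynomial.C (hZero r c), fun f => ⟨MvPolynomial.C c * f, ?_, ?_⟩⟩
      · rw [op_C_mul]
        rfl
      · rw [map_mul, MvPolynomial.map_C]
    · exact ⟨MvPolynomial.X i, fun f => hD_mul_op i f⟩
  | zero =>
    refine ⟨0, fun f => ⟨0, ?_, by rw [map_zero, zero_mul]⟩⟩
    have h0 := op_C_mul 0 (0 : MvPolynomial (Fin r) (Kh r))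
    rw [mul_zero, map_zero, zero_mul] at h0
    rw [h0]
    exact zero_mul (op f)
  | one => exact ⟨1, fun f => ⟨f, one_mul _, (one_mul _).symm⟩⟩
  | add x y hx hy h1 h2 =>
    obtain ⟨p, hp⟩ := h1
    obtain ⟨q, hq⟩ := h2
    refine ⟨p + q, fun f => ?_⟩
    obtain ⟨g, hg, hg'⟩ := hp f
    obtain ⟨k, hk, hk'⟩ := hq f
    refine ⟨g + k, ?_, by rw [map_add, hg', hk', add_mul]⟩
    rw [op_add, ← hg, ← hk, ← add_mul]
    rfl
  | neg x hx h1 =>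
    obtain ⟨p, hp⟩ := h1
    refine ⟨-p, fun f => ?_⟩
    obtain ⟨g, hg, hg'⟩ := hp f
    refine ⟨MvPolynomial.C (-1) * g, ?_, by
      rw [map_mul, hg', MvPolynomial.map_C, map_neg, map_one, map_neg, map_one]
      ring⟩
    rw [op_C_mul, ← hg, map_neg, map_one, neg_one_mul, ← neg_mul]
    rfl
  | mul x y hx hy h1 h2 =>
    obtain ⟨p, hp⟩ := h1
    obtain ⟨q, hq⟩ := h2
    refine ⟨p * q, fun f => ?_⟩
    obtain ⟨k, hk, hk'⟩ := hq f
    obtain ⟨g, hg, hg'⟩ := hp k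
    refine ⟨g, ?_, by rw [hg', hk', mul_assoc]⟩
    rw [← hg, ← hk, ← mul_assoc]
    rfl

theorem op_surjective : Function.Surjective (op (r := r)) := by
  intro P
  obtain ⟨p, hp⟩ := exists_symbol P
  obtain ⟨g, hg, -⟩ := hp 1
  rw [op_one, mul_one] at hg
  exact ⟨g, hg.symm⟩

/-- The bijection `op`; its inverse is the map `S`. -/
def opEquiv (r : ℕ) : MvPolynomial (Fin r) (Kh r) ≃+ Dh r :=
  AddEquiv.ofBijective (AddMonoidHom.mk' op op_add) ⟨op_injective, op_surjective⟩

theorem opEquiv_symm_op (f : MvPolynomial (Fin r) (Kh r)) : (opEquiv r).symm (op f) = f :=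
  (opEquiv r).symm_apply_apply f

theorem map_hZero_opEquiv_symm_mul (P Q : Dh r) :
    MvPolynomial.map (hZero r) ((opEquiv r).symm (P * Q)) =
      MvPolynomial.map (hZero r) ((opEquiv r).symm P) *
        MvPolynomial.map (hZero r) ((opEquiv r).symm Q) := by
  obtain ⟨p, hp⟩ := exists_symbol P
  obtain ⟨f, rfl⟩ := op_surjective Q
  obtain ⟨g, hg, hg'⟩ := hp f
  obtain ⟨k, hk, hk'⟩ := hp 1
  rw [op_one, mul_one] at hk
  rw [hg, hk, opEquiv_symm_op, opEquiv_symm_op, opEquiv_symm_op, hg', hk', map_one, mul_one]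

/-- The symbol `lim_{h → 0} S(P)` of an operator `P`. -/
def symD (r : ℕ) : Dh r →+* MvPolynomial (Fin r) (K r) where
  toFun P := MvPolynomial.map (hZero r) ((opEquiv r).symm P)
  map_one' := by rw [← op_one, opEquiv_symm_op, map_one]
  map_mul' := map_hZero_opEquiv_symm_mul
  map_zero' := by rw [map_zero, map_zero]
  map_add' P Q := by rw [map_add, map_add]

theorem symD_op (f : MvPolynomial (Fin r) (Kh r)) : symD r (op f) = MvPolynomial.map (hZero r) f := by
  change MvPolynomial.map (hZero r) ((opEquiv r).symm (op f)) = _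
  rw [opEquiv_symm_op]

theorem symD_coeffD (c : Kh r) : symD r (coeffD r c) = MvPolynomial.C (hZero r c) := by
  have := op_monomial 0 c
  rw [monD_zero, mul_one] at this
  rw [← this, symD_op, MvPolynomial.map_monomial]
  rfl

theorem symD_monD (I : Fin r →₀ ℕ) : symD r (monD I) = MvPolynomial.monomial I 1 := by
  have := op_monomial I (1 : Kh r)
  rw [map_one (coeffD r), one_mul] at this
  rw [← this, symD_op, MvPolynomial.map_monomial, map_one]

theorem symD_hD (i : Fin r) : symD r (hD i) = MvPolynomial.X i := by
  rw [← monD_single, symD_monD]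
  rfl

/-! ## The module `M^h` -/

variable {Rel : Fin u → MvPolynomial (Fin r) (K r)} {d : Fin u → MvPolynomial (Fin r) (Kh r)}

theorem Kh_smul_eq (f : Kh r) (x : Mh d) : f • x = coeffD r f • x := rfl

theorem hD_smul_smul (i : Fin r) (f : Kh r) (x : Mh d) :
    hD i • f • x = f • hD i • x + hEuler i f • x := by
  rw [Kh_smul_eq, Kh_smul_eq, Kh_smul_eq, smul_smul, smul_smul, hD_mul_coeffD, add_smul]

/-- The class in `𝒜` of the symbol of an operator. -/
def symA (Rel : Fin u → MvPolynomial (Fin r) (K r)) : Dh r →+* Alg Rel :=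
  (Ideal.Quotient.mk _).comp (symD r)

/-- The symbol map from `M^h` to `𝒜`. -/
def symM (h : ∀ j, MvPolynomial.map (hZero r) (d j) = Rel j) : Mh d →ₛₗ[symA Rel] Alg Rel :=
  (leftIdeal d).liftQ
    ({ toFun := symA Rel
       map_add' := map_add _
       map_smul' := fun P Q => map_mul (symA Rel) P Q } : Dh r →ₛₗ[symA Rel] Alg Rel)
    (Submodule.span_le.2 (by
      rintro _ ⟨j, rfl⟩
      change Ideal.Quotient.mk _ (symD r (op (d j))) = 0
      rw [symD_op, h, Ideal.Quotient.eq_zero_iff_mem]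
      exact Ideal.subset_span ⟨j, rfl⟩))

theorem symM_clsD (h : ∀ j, MvPolynomial.map (hZero r) (d j) = Rel j) (P : Dh r) :
    symM h (clsD d P) = cls Rel (symD r P) := rfl

theorem symM_Dh_smul (h : ∀ j, MvPolynomial.map (hZero r) (d j) = Rel j) (P : Dh r) (x : Mh d) :
    symM h (P • x) = cls Rel (symD r P) * symM h x :=
  (symM h).map_smulₛₗ P x

theorem K_smul_eq (c : K r) (x : Alg Rel) : c • x = cls Rel (MvPolynomial.C c) * x := by
  obtain ⟨p, rfl⟩ := Ideal.Quotient.mk_surjective x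
  change cls Rel (c • p) = _
  rw [MvPolynomial.smul_eq_C_mul]
  exact map_mul (Ideal.Quotient.mk _) _ _

theorem symM_Kh_smul (h : ∀ j, MvPolynomial.map (hZero r) (d j) = Rel j) (f : Kh r) (x : Mh d) :
    symM h (f • x) = hZero r f • symM h x := by
  rw [Kh_smul_eq, symM_Dh_smul, symD_coeffD, K_smul_eq]

end

noncomputable section

variable {r u s : ℕ}

/-! ## Rescaling -/

/-- The substitution `q_i ↦ c^{|q_i|} q_i`, `h ↦ c² h`. -/
def scaleKh (qdeg : Fin r → ℕ) (c : ℂ) : Kh r →+* Kh r :=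
  MvPolynomial.eval₂Hom (MvPolynomial.C.comp
      (Polynomial.compRingHom (Polynomial.C (c ^ 2) * Polynomial.X)))
    fun i => MvPolynomial.C (Polynomial.C (c ^ qdeg i)) * MvPolynomial.X i

theorem scaleKh_monomial (qdeg : Fin r → ℕ) (c : ℂ) (a : Fin r →₀ ℕ) (p : Polynomial ℂ) :
    scaleKh qdeg c (MvPolynomial.monomial a p) = MvPolynomial.monomial a
      (p.comp (Polynomial.C (c ^ 2) * Polynomial.X) * Polynomial.C (c ^ qWeight qdeg a)) := by
  rw [scaleKh, MvPolynomial.eval₂Hom_monomial, Finsupp.prod_fintype _ _ (by simp)]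
  simp only [mul_pow, Finset.prod_mul_distrib, ← map_pow, ← map_prod, ← pow_mul,
    Finset.prod_pow_eq_pow_sum]
  rw [MvPolynomial.monomial_eq, map_mul, mul_assoc, Finsupp.prod_fintype _ _ (by simp)]
  rfl

theorem coeff_scaleKh (qdeg : Fin r → ℕ) (c : ℂ) (f : Kh r) (a : Fin r →₀ ℕ) (m : ℕ) :
    ((scaleKh qdeg c f).coeff a).coeff m =
      c ^ (2 * m + qWeight qdeg a) * (f.coeff a).coeff m := by
  classical
  induction f using MvPolynomial.induction_on' with
  | monomial b p =>
    rw [scaleKh_monomial, MvPolynomial.coeff_monomial, MvPolynomial.coeff_monomial]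
    split_ifs with h
    · rw [Polynomial.coeff_mul_C, Polynomial.comp_C_mul_X_coeff, h, pow_add, pow_mul]
      ring
    · simp
  | add p q hp hq =>
    rw [map_add, MvPolynomial.coeff_add, Polynomial.coeff_add, hp, hq, MvPolynomial.coeff_add,
      Polynomial.coeff_add, mul_add]

theorem Kh_ext {f g : Kh r} (h : ∀ a m, (f.coeff a).coeff m = (g.coeff a).coeff m) : f = g :=
  MvPolynomial.ext _ _ fun a => Polynomial.ext fun m => h a m

theorem scaleKh_inv {c : ℂ} (hc : c ≠ 0) (qdeg : Fin r → ℕ) (f : Kh r) :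
    scaleKh qdeg c (scaleKh qdeg c⁻¹ f) = f :=
  Kh_ext fun a m => by
    rw [coeff_scaleKh, coeff_scaleKh, ← mul_assoc, ← mul_pow, mul_inv_cancel₀ hc, one_pow, one_mul]

theorem scaleKh_inv' {c : ℂ} (hc : c ≠ 0) (qdeg : Fin r → ℕ) (f : Kh r) :
    scaleKh qdeg c⁻¹ (scaleKh qdeg c f) = f := by
  simpa using scaleKh_inv (inv_ne_zero hc) qdeg f

/-- The constant `z` of `K[h]`. -/
def cst (r : ℕ) (z : ℂ) : Kh r := MvPolynomial.C (Polynomial.C z)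

theorem coeff_cst_mul (z : ℂ) (f : Kh r) (a : Fin r →₀ ℕ) (m : ℕ) :
    ((cst r z * f).coeff a).coeff m = z * (f.coeff a).coeff m := by
  rw [cst, MvPolynomial.coeff_C_mul, Polynomial.coeff_C_mul]

theorem cst_mul (z w : ℂ) : cst r (z * w) = cst r z * cst r w := by
  rw [cst, map_mul, map_mul]
  rfl

theorem cst_one : cst r 1 = 1 := by
  rw [cst, map_one, map_one]

theorem scaleKh_hEuler (qdeg : Fin r → ℕ) (c : ℂ) (i : Fin r) (f : Kh r) :
    scaleKh qdeg c (hEuler i f) = cst r (c ^ 2) * hEuler i (scaleKh qdeg c f) :=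
  Kh_ext fun a m => by
    rw [coeff_scaleKh, coeff_cst_mul, coeff_hEuler, coeff_hEuler, mul_assoc, mul_assoc]
    cases m with
    | zero => rw [Polynomial.coeff_X_mul_zero, Polynomial.coeff_X_mul_zero, mul_zero, mul_zero]
    | succ m =>
      rw [Polynomial.coeff_X_mul, Polynomial.coeff_X_mul, ← Polynomial.C_eq_natCast,
        Polynomial.coeff_C_mul, Polynomial.coeff_C_mul, coeff_scaleKh]
      ring

theorem scaleKh_smul (qdeg : Fin r → ℕ) (c : ℂ) (p : Polynomial ℂ) (f : Kh r) :
    scaleKh qdeg c (p • f) = p.comp (Polynomial.C (c ^ 2) * Polynomial.X) • scaleKh qdeg c f := by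
  rw [MvPolynomial.smul_eq_C_mul, MvPolynomial.smul_eq_C_mul, map_mul]
  congr 1
  exact MvPolynomial.eval₂Hom_C _ _ _

/-- Conjugation of operators by the rescaling. -/
def conjEnd (qdeg : Fin r → ℕ) {c : ℂ} (hc : c ≠ 0) :
    Module.End (Polynomial ℂ) (Kh r) →+* Module.End (Polynomial ℂ) (Kh r) where
  toFun P :=
    { toFun := fun f => scaleKh qdeg c (P (scaleKh qdeg c⁻¹ f))
      map_add' := fun f g => by rw [map_add, map_add, map_add]
      -- The two substitutions `h ↦ c^{-2} h` and `h ↦ c² h` cancel, so conjugation preserves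
      -- linearity over `ℂ[h]`.
      map_smul' := fun p f => by
        rw [scaleKh_smul, map_smul, scaleKh_smul, Polynomial.comp_assoc, RingHom.id_apply]
        congr 1
        rw [Polynomial.mul_comp, Polynomial.C_comp, Polynomial.X_comp, ← mul_assoc, ← map_mul,
          ← mul_pow, inv_mul_cancel₀ hc, one_pow, map_one, one_mul, Polynomial.comp_X] }
  map_one' := LinearMap.ext fun f => scaleKh_inv hc qdeg f
  map_mul' P Q := LinearMap.ext fun f => by
    change scaleKh qdeg c (P (Q _)) =
      scaleKh qdeg c (P (scaleKh qdeg c⁻¹ (scaleKh qdeg c (Q (scaleKh qdeg c⁻¹ f)))))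
    rw [scaleKh_inv' hc]
  map_zero' := LinearMap.ext fun f => map_zero (scaleKh qdeg c)
  map_add' P Q := LinearMap.ext fun f => map_add (scaleKh qdeg c) _ _

theorem conjEnd_apply (qdeg : Fin r → ℕ) {c : ℂ} (hc : c ≠ 0)
    (P : Module.End (Polynomial ℂ) (Kh r)) (f : Kh r) :
    conjEnd qdeg hc P f = scaleKh qdeg c (P (scaleKh qdeg c⁻¹ f)) := rfl

theorem conjEnd_mulLeft (qdeg : Fin r → ℕ) {c : ℂ} (hc : c ≠ 0) (f : Kh r) :
    conjEnd qdeg hc (LinearMap.mulLeft (Polynomial ℂ) f) =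
      LinearMap.mulLeft (Polynomial ℂ) (scaleKh qdeg c f) :=
  LinearMap.ext fun g => by
    rw [conjEnd_apply, LinearMap.mulLeft_apply, map_mul, scaleKh_inv hc, LinearMap.mulLeft_apply]

theorem conjEnd_hEuler (qdeg : Fin r → ℕ) {c : ℂ} (hc : c ≠ 0) (i : Fin r) :
    conjEnd qdeg hc (hEuler i) =
      LinearMap.mulLeft (Polynomial ℂ) (cst r (c ^ 2)) * hEuler i :=
  LinearMap.ext fun g => by
    rw [conjEnd_apply, scaleKh_hEuler, scaleKh_inv hc, Module.End.mul_apply,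
      LinearMap.mulLeft_apply]

theorem mulLeft_mem_Dh (f : Kh r) : LinearMap.mulLeft (Polynomial ℂ) f ∈ Dh r :=
  Subring.subset_closure (Or.inl ⟨f, rfl⟩)

theorem hEuler_mem_Dh (i : Fin r) : hEuler i ∈ Dh r :=
  Subring.subset_closure (Or.inr ⟨i, rfl⟩)

theorem conjEnd_mem_Dh (qdeg : Fin r → ℕ) {c : ℂ} (hc : c ≠ 0)
    (P : Module.End (Polynomial ℂ) (Kh r)) (hP : P ∈ Dh r) : conjEnd qdeg hc P ∈ Dh r := by
  induction hP using Subring.closure_induction with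
  | mem x hx =>
    rcases hx with ⟨f, rfl⟩ | ⟨i, rfl⟩
    · rw [conjEnd_mulLeft]
      exact mulLeft_mem_Dh _
    · rw [conjEnd_hEuler]
      exact Subring.mul_mem _ (mulLeft_mem_Dh _) (hEuler_mem_Dh i)
  | zero => rw [map_zero]; exact Subring.zero_mem _
  | one => rw [map_one]; exact Subring.one_mem _
  | add x y _ _ hx hy => rw [map_add]; exact Subring.add_mem _ hx hy
  | neg x _ hx => rw [map_neg]; exact Subring.neg_mem _ hx
  | mul x y _ _ hx hy => rw [map_mul]; exact Subring.mul_mem _ hx hy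

/-- The automorphism of `D^h` induced by the rescaling. -/
def conjD (qdeg : Fin r → ℕ) {c : ℂ} (hc : c ≠ 0) : Dh r →+* Dh r :=
  (conjEnd qdeg hc).restrict (Dh r) (Dh r) (conjEnd_mem_Dh qdeg hc)

theorem conjD_coeffD (qdeg : Fin r → ℕ) {c : ℂ} (hc : c ≠ 0) (f : Kh r) :
    conjD qdeg hc (coeffD r f) = coeffD r (scaleKh qdeg c f) :=
  Subtype.ext (conjEnd_mulLeft qdeg hc f)

theorem conjD_hD (qdeg : Fin r → ℕ) {c : ℂ} (hc : c ≠ 0) (i : Fin r) :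
    conjD qdeg hc (hD i) = coeffD r (cst r (c ^ 2)) * hD i :=
  Subtype.ext (conjEnd_hEuler qdeg hc i)

theorem coeffD_cst_comm (z : ℂ) (P : Dh r) :
    coeffD r (cst r z) * P = P * coeffD r (cst r z) := by
  refine Subtype.ext (LinearMap.ext fun f => ?_)
  change cst r z * (P : Module.End (Polynomial ℂ) (Kh r)) f =
    (P : Module.End (Polynomial ℂ) (Kh r)) (cst r z * f)
  rw [cst, ← MvPolynomial.smul_eq_C_mul, ← MvPolynomial.smul_eq_C_mul, map_smul]

theorem conjD_monD (qdeg : Fin r → ℕ) {c : ℂ} (hc : c ≠ 0) (I : Fin r →₀ ℕ) :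
    conjD qdeg hc (monD I) = coeffD r (cst r (c ^ (2 * I.degree))) * monD I := by
  have hadd : ∀ I J : Fin r →₀ ℕ,
      conjD qdeg hc (monD I) = coeffD r (cst r (c ^ (2 * I.degree))) * monD I →
      conjD qdeg hc (monD J) = coeffD r (cst r (c ^ (2 * J.degree))) * monD J →
      conjD qdeg hc (monD (I + J)) =
        coeffD r (cst r (c ^ (2 * (I + J).degree))) * monD (I + J) := by
    intro I J hI hJ
    rw [monD_add, map_mul, hI, hJ, map_add, mul_add, pow_add, cst_mul, map_mul, mul_assoc,
      ← mul_assoc (monD I), ← coeffD_cst_comm]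
    simp only [mul_assoc]
  have h0 : conjD qdeg hc (monD 0) = coeffD r (cst r (c ^ (2 * (0 : Fin r →₀ ℕ).degree))) *
      monD 0 := by
    rw [monD_zero, map_one, map_zero, mul_zero, pow_zero, cst_one, map_one, mul_one]
  induction I using Finsupp.induction_linear with
  | zero => exact h0
  | add I J hI hJ => exact hadd I J hI hJ
  | single i n =>
    induction n with
    | zero => simpa using h0
    | succ n ih =>
      rw [Finsupp.single_add]
      refine hadd _ _ ih ?_
      rw [monD_single, conjD_hD, Finsupp.degree_single, mul_one]

/-- A homogeneous operator is an eigenvector of the rescaling, so the rescaling preserves the left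
ideal generated by such operators. -/
theorem conjD_op {qdeg : Fin r → ℕ} {c : ℂ} (hc : c ≠ 0) {f : MvPolynomial (Fin r) (Kh r)}
    (hf : IsHomogeneousOp qdeg f) :
    ∃ m : ℕ, conjD qdeg hc (op f) = coeffD r (cst r (c ^ m)) * op f := by
  obtain ⟨m, hm⟩ := hf
  refine ⟨m, ?_⟩
  rw [op, map_sum, Finset.mul_sum]
  refine Finset.sum_congr rfl fun I _ => ?_
  rw [map_mul, conjD_coeffD, conjD_monD, ← mul_assoc, ← mul_assoc, ← map_mul, ← map_mul]
  congr 2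
  refine Kh_ext fun a k => ?_
  rw [mul_comm, coeff_cst_mul, coeff_cst_mul, coeff_scaleKh, ← mul_assoc, ← pow_add]
  by_cases h0 : ((f.coeff I).coeff a).coeff k = 0
  · rw [h0, mul_zero, mul_zero]
  · rw [← hm I a k h0, qWeight]
    congr 2
    ring

variable {Rel : Fin u → MvPolynomial (Fin r) (K r)} {d : Fin u → MvPolynomial (Fin r) (Kh r)}

/-- The rescaling of `M^h`. -/
def scaleM {qdeg : Fin r → ℕ} (hd : ∀ j, IsHomogeneousOp qdeg (d j)) {c : ℂ} (hc : c ≠ 0) :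
    Mh d →ₛₗ[conjD qdeg hc] Mh d :=
  (leftIdeal d).liftQ
    ({ toFun := fun P => clsD d (conjD qdeg hc P)
       map_add' := fun P Q => by rw [map_add]; rfl
       map_smul' := fun P Q => by rw [smul_eq_mul, map_mul]; rfl } :
      Dh r →ₛₗ[conjD qdeg hc] Mh d)
    (Submodule.span_le.2 (by
      rintro _ ⟨j, rfl⟩
      change clsD d (conjD qdeg hc (op (d j))) = 0
      obtain ⟨m, hm⟩ := conjD_op hc (hd j)
      rw [hm]
      refine (Submodule.Quotient.mk_eq_zero _).2 ?_
      exact Submodule.smul_mem _ _ (Submodule.subset_span ⟨j, rfl⟩)))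

theorem scaleM_clsD {qdeg : Fin r → ℕ} (hd : ∀ j, IsHomogeneousOp qdeg (d j)) {c : ℂ}
    (hc : c ≠ 0) (P : Dh r) : scaleM hd hc (clsD d P) = clsD d (conjD qdeg hc P) := rfl

theorem scaleM_Dh_smul {qdeg : Fin r → ℕ} (hd : ∀ j, IsHomogeneousOp qdeg (d j)) {c : ℂ}
    (hc : c ≠ 0) (P : Dh r) (x : Mh d) :
    scaleM hd hc (P • x) = conjD qdeg hc P • scaleM hd hc x :=
  (scaleM hd hc).map_smulₛₗ P x

theorem scaleM_Kh_smul {qdeg : Fin r → ℕ} (hd : ∀ j, IsHomogeneousOp qdeg (d j)) {c : ℂ}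
    (hc : c ≠ 0) (f : Kh r) (x : Mh d) :
    scaleM hd hc (f • x) = scaleKh qdeg c f • scaleM hd hc x := by
  rw [Kh_smul_eq, scaleM_Dh_smul, conjD_coeffD]
  rfl

/-! ## The matrices `hΩ_i` and `ω_i` -/

namespace StandardBasis

variable (B : StandardBasis Rel d s)

theorem hD_smul_P (i : Fin r) (j : Fin (s + 1)) : hD i • B.P j = ∑ k, B.hOmega i k j • B.P k :=
  (B.P.sum_repr _).symm

/-- Compare the coordinates of `h∂_l h∂_i P_j` and `h∂_i h∂_l P_j`. -/
theorem hOmega_flat (l i : Fin r) (m j : Fin (s + 1)) :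
    hEuler l (B.hOmega i m j) + (B.hOmega l * B.hOmega i) m j =
      hEuler i (B.hOmega l m j) + (B.hOmega i * B.hOmega l) m j := by
  have key : ∀ l i : Fin r, hD l • hD i • B.P j =
      ∑ m, (hEuler l (B.hOmega i m j) + (B.hOmega l * B.hOmega i) m j) • B.P m := by
    intro l i
    rw [hD_smul_P, Finset.smul_sum]
    simp only [hD_smul_smul, hD_smul_P, Finset.smul_sum, add_smul, Finset.sum_add_distrib,
      Matrix.mul_apply, Finset.sum_smul, smul_smul]
    rw [add_comm, Finset.sum_comm]
    simp only [mul_comm]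
  have h1 := key l i
  rw [smul_smul, hD_comm, ← smul_smul, key i l] at h1
  have h2 := congrArg (fun x => B.P.repr x m) h1
  simp only [B.P.repr_sum_self] at h2
  exact h2.symm

theorem hOmega_coeff {qdeg : Fin r → ℕ} (hd : ∀ j, IsHomogeneousOp qdeg (d j)) (i : Fin r)
    (k j : Fin (s + 1)) (a : Fin r →₀ ℕ) (m : ℕ) (h : ((B.hOmega i k j).coeff a).coeff m ≠ 0) :
    2 * m + qWeight qdeg a + 2 * (B.exp k).degree = 2 * (B.exp j).degree + 2 := by
  -- Rescaling by the single value `c = 2` is enough, because distinct powers of 2 separate the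
  -- degrees.
  have h2 : (2 : ℂ) ≠ 0 := two_ne_zero
  have hP : ∀ j, scaleM hd h2 (B.P j) = cst r (2 ^ (2 * (B.exp j).degree)) • B.P j := by
    intro j
    rw [B.P_apply, scaleM_clsD, conjD_monD]
    rfl
  have h1 := congrArg (scaleM hd h2) (B.hD_smul_P i j)
  rw [scaleM_Dh_smul, hP, conjD_hD, map_sum, Kh_smul_eq, smul_smul, mul_assoc,
    ← coeffD_cst_comm, ← mul_assoc, ← map_mul, ← cst_mul, ← smul_smul, ← Kh_smul_eq, hD_smul_P,
    Finset.smul_sum] at h1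
  simp only [scaleM_Kh_smul, hP, smul_smul] at h1
  have h3 := congrArg (fun x => B.P.repr x k) h1
  simp only [B.P.repr_sum_self] at h3
  have h4 := congrArg (fun f : Kh r => (f.coeff a).coeff m) h3
  rw [coeff_cst_mul, mul_comm (scaleKh _ _ _), coeff_cst_mul, coeff_scaleKh, ← mul_assoc] at h4
  have h5 := mul_right_cancel₀ h h4
  rw [← pow_add, ← pow_add] at h5
  have h6 : 2 + 2 * (B.exp j).degree = 2 * (B.exp k).degree + (2 * m + qWeight qdeg a) :=
    Nat.pow_right_injective le_rfl (by exact_mod_cast h5)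
  omega

/-- The symbol map `symM` sends `P_j` to `c_j` and the action of `h∂_i` to multiplication by `b_i`.
-/
theorem hZero_hOmega (h : ∀ j, MvPolynomial.map (hZero r) (d j) = Rel j) (i : Fin r)
    (k j : Fin (s + 1)) : hZero r (B.hOmega i k j) = B.omega i k j := by
  have hP : ∀ j, symM h (B.P j) = B.c j := fun j => by
    rw [B.P_apply, symM_clsD, symD_monD, B.c_apply]
  have h1 := congrArg (symM h) (B.hD_smul_P i j)
  rw [symM_Dh_smul, symD_hD, hP, map_sum] at h1
  simp only [symM_Kh_smul, hP] at h1
  rw [omega, LinearMap.toMatrix_apply, LinearMap.mulLeft_apply, h1, B.c.repr_sum_self]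

end StandardBasis

/-! ### Passage to power series -/

theorem coeff_toFKh (f : Kh r) (a : Fin r →₀ ℕ) (m : ℕ) :
    PowerSeries.coeff m (MvPowerSeries.coeff a (toFKh r f)) = (f.coeff a).coeff m := by
  rw [toFKh, RingHom.comp_apply, MvPolynomial.coeToMvPowerSeries.ringHom_apply,
    MvPolynomial.coeff_coe, MvPolynomial.coeff_map]
  exact Polynomial.coeff_coe _ _

theorem FKh_ext {f g : FKh r} (h : ∀ a m, PowerSeries.coeff m (MvPowerSeries.coeff a f) =
    PowerSeries.coeff m (MvPowerSeries.coeff a g)) : f = g :=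
  MvPowerSeries.ext fun a => PowerSeries.ext fun m => h a m

theorem toFKh_injective : Function.Injective (toFKh r) := fun f g h =>
  Kh_ext fun a m => by rw [← coeff_toFKh, h, coeff_toFKh]

theorem toFKh_hEuler (i : Fin r) (f : Kh r) :
    toFKh r (hEuler i f) = hF r * eulerF i (toFKh r f) :=
  FKh_ext fun a m => by
    rw [coeff_toFKh, coeff_hEuler, hF, MvPowerSeries.coeff_C_mul, coeff_eulerF, mul_assoc]
    cases m with
    | zero => rw [Polynomial.coeff_X_mul_zero, PowerSeries.coeff_zero_X_mul]
    | succ m =>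
      rw [Polynomial.coeff_X_mul, PowerSeries.coeff_succ_X_mul, ← Polynomial.C_eq_natCast,
        Polynomial.coeff_C_mul, ← map_natCast (PowerSeries.C (R := ℂ)), PowerSeries.coeff_C_mul,
        coeff_toFKh]

theorem hZeroF_toFKh (f : Kh r) : hZeroF r (toFKh r f) = toFK r (hZero r f) := by
  refine MvPowerSeries.ext fun a => ?_
  rw [hZeroF, MvPowerSeries.coeff_map, toFK, MvPolynomial.coeToMvPowerSeries.ringHom_apply,
    MvPolynomial.coeff_coe, hZero, MvPolynomial.coeff_map,
    ← PowerSeries.coeff_zero_eq_constantCoeff_apply, coeff_toFKh]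
  rfl

namespace StandardBasis

variable (B : StandardBasis Rel d s)

/-- The matrices `hΩ_i` over the ring of power series. -/
def hOmegaF (i : Fin r) : Matrix (Fin (s + 1)) (Fin (s + 1)) (FKh r) :=
  (B.hOmega i).map (toFKh r)

theorem isFlat_hOmegaF : IsFlat B.hOmegaF := by
  intro l i
  ext m j : 1
  have h1 := congrArg (toFKh r) (B.hOmega_flat l i m j)
  have h2 : ∀ l i : Fin r, toFKh r ((B.hOmega l * B.hOmega i) m j) =
      (B.hOmegaF l * B.hOmegaF i) m j := fun l i => by
    rw [hOmegaF, hOmegaF, ← Matrix.map_mul]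
    rfl
  rw [map_add, map_add, toFKh_hEuler, toFKh_hEuler, h2, h2] at h1
  exact h1

theorem isGraded_hOmegaF {qdeg : Fin r → ℕ} (hd : ∀ j, IsHomogeneousOp qdeg (d j)) (i : Fin r) :
    IsGraded qdeg (fun j => (B.exp j).degree) 2 (B.hOmegaF i) := by
  intro k j a m h
  refine B.hOmega_coeff hd i k j a m ?_
  rwa [← coeff_toFKh]

theorem hZeroF_hOmegaF (h : ∀ j, MvPolynomial.map (hZero r) (d j) = Rel j) (i : Fin r) :
    (B.hOmegaF i).map (hZeroF r) = (B.omega i).map (toFK r) := by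
  ext k j : 1
  rw [Matrix.map_apply, hOmegaF, Matrix.map_apply, hZeroF_toFKh, B.hZero_hOmega h,
    Matrix.map_apply]

end StandardBasis

end

noncomputable section

variable {r u s : ℕ}

/-! ## Normalized gauge transformations -/

theorem qCoeff_zero_eq {ι : Type*} [Fintype ι] [DecidableEq ι] (M : Matrix ι ι (FKh r)) :
    qCoeff 0 M = M.map (MvPowerSeries.constantCoeff (σ := Fin r) (R := PowerSeries ℂ)) := by
  ext k j : 1
  rw [qCoeff_apply, MvPowerSeries.coeff_zero_eq_constantCoeff_apply, Matrix.map_apply]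

theorem coeff_FKtoFKh (f : FK r) (a : Fin r →₀ ℕ) :
    MvPowerSeries.coeff a (FKtoFKh r f) = PowerSeries.C (MvPowerSeries.coeff a f) := by
  rw [FKtoFKh, MvPowerSeries.coeff_map]

theorem hConst_map_FKtoFKh {ι : Type*} [Fintype ι] [DecidableEq ι] (M : Matrix ι ι (FK r))
    (a : Fin r →₀ ℕ) : HConst (qCoeff a (M.map (FKtoFKh r))) := fun m => by
  ext k j : 1
  rw [hCoeff_apply, qCoeff_apply, Matrix.map_apply, coeff_FKtoFKh, PowerSeries.coeff_C,
    if_neg (Nat.succ_ne_zero m), Matrix.zero_apply]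

theorem coeff_hZeroF (f : FKh r) (a : Fin r →₀ ℕ) :
    MvPowerSeries.coeff a (hZeroF r f) = PowerSeries.coeff 0 (MvPowerSeries.coeff a f) := by
  rw [hZeroF, MvPowerSeries.coeff_map, PowerSeries.coeff_zero_eq_constantCoeff_apply]

theorem eq_map_FKtoFKh {ι : Type*} [Fintype ι] [DecidableEq ι] {M : Matrix ι ι (FKh r)}
    (h : ∀ a, HConst (qCoeff a M)) : M = (M.map (hZeroF r)).map (FKtoFKh r) := by
  ext k j : 1
  refine FKh_ext fun a m => ?_
  rw [Matrix.map_apply, Matrix.map_apply, coeff_FKtoFKh, PowerSeries.coeff_C, coeff_hZeroF]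
  cases m with
  | zero => rw [if_pos rfl]
  | succ m =>
    rw [if_neg (Nat.succ_ne_zero m)]
    exact congrFun (congrFun (h a m) k) j

theorem map_hZeroF_matD {ι : Type*} [Fintype ι] [DecidableEq ι] (i : Fin r)
    (M : Matrix ι ι (FKh r)) : (matD i M).map (hZeroF r) = 0 := by
  ext k j : 1
  rw [matD_apply, Matrix.map_apply, Matrix.smul_apply, smul_eq_mul, map_mul]
  have : hZeroF r (hF r) = 0 := by
    rw [hZeroF, hF, MvPowerSeries.map_C, PowerSeries.constantCoeff_X, map_zero]
  rw [this, zero_mul, Matrix.zero_apply]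

variable {Rel : Fin u → MvPolynomial (Fin r) (K r)} {d : Fin u → MvPolynomial (Fin r) (Kh r)}

namespace StandardBasis

variable {B : StandardBasis Rel d s}

/-- The weights of the standard basis. -/
def weight (B : StandardBasis Rel d s) (j : Fin (s + 1)) : ℕ := (B.exp j).degree

theorem IsNormalizedGauge.isGauge {L : Matrix (Fin (s + 1)) (Fin (s + 1)) (FKh r)}
    (hL : B.IsNormalizedGauge L) : IsGauge L B.hOmegaF
      fun i => (Q₀F L * (B.omega i).map (toFK r) * (Q₀F L)⁻¹).map (FKtoFKh r) :=
  hL.gauge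

theorem IsNormalizedGauge.qCoeff_zero {L : Matrix (Fin (s + 1)) (Fin (s + 1)) (FKh r)}
    (hL : B.IsNormalizedGauge L) : qCoeff 0 L = 1 := by
  rw [qCoeff_zero_eq, hL.normalized]

theorem IsNormalizedGauge.unique {qdeg : Fin r → ℕ} (hd : ∀ j, IsHomogeneousOp qdeg (d j))
    {L L' : Matrix (Fin (s + 1)) (Fin (s + 1)) (FKh r)} (hL : B.IsNormalizedGauge L)
    (hL' : B.IsNormalizedGauge L') : L = L' :=
  gauge_unique (isNilpotent_of_isGraded (IsGraded.sum fun i _ => B.isGraded_hOmegaF hd i))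
    hL.qCoeff_zero hL'.qCoeff_zero hL.isGauge hL'.isGauge (fun _ _ => hConst_map_FKtoFKh _ _)
    (fun _ _ => hConst_map_FKtoFKh _ _)

theorem coeff_constantCoeff_hOmega (B : StandardBasis Rel d s) (i : Fin r) (k j : Fin (s + 1))
    (m : ℕ) : (MvPolynomial.constantCoeff (B.hOmega i k j)).coeff m =
      hCoeff m (qCoeff 0 (B.hOmegaF i)) k j :=
  (coeff_toFKh _ 0 m).symm

theorem coeff_zero_constantCoeff_hOmega (h : ∀ j, MvPolynomial.map (hZero r) (d j) = Rel j)
    (B : StandardBasis Rel d s) (i : Fin r) (k j : Fin (s + 1)) :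
    (MvPolynomial.constantCoeff (B.hOmega i k j)).coeff 0 = qZero r (B.omega i k j) := by
  rw [← B.hZero_hOmega h, hZero, qZero, MvPolynomial.constantCoeff_map]
  rfl

/-- The part of order `h^0` agrees automatically, so the condition concerns only the positive powers
of `h`. -/
theorem isPolarAtZero_iff (h : ∀ j, MvPolynomial.map (hZero r) (d j) = Rel j)
    (B : StandardBasis Rel d s) : B.IsPolarAtZero ↔ ∀ i, HConst (qCoeff 0 (B.hOmegaF i)) := by
  constructor
  · intro hB i m
    ext k j : 1
    rw [← coeff_constantCoeff_hOmega, hB i k j, Polynomial.coeff_C_succ, Matrix.zero_apply]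
  · intro hB i k j
    refine Polynomial.ext fun m => ?_
    cases m with
    | zero => rw [coeff_zero_constantCoeff_hOmega h, Polynomial.coeff_C_zero]
    | succ m => rw [coeff_constantCoeff_hOmega, hB i m, Polynomial.coeff_C_succ, Matrix.zero_apply]

/-- At `q = 0` the gauge is the identity and its derivative vanishes, so `hΩ_i^h` equals the
`h`-free target there. -/
theorem IsNormalizedGauge.isPolarAtZero (h : ∀ j, MvPolynomial.map (hZero r) (d j) = Rel j)
    {L : Matrix (Fin (s + 1)) (Fin (s + 1)) (FKh r)} (hL : B.IsNormalizedGauge L) :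
    B.IsPolarAtZero := by
  rw [isPolarAtZero_iff h]
  intro i
  have h1 := congrArg (qCoeff 0) (hL.isGauge i)
  rw [map_sub, qCoeff_mul_zero, qCoeff_mul_zero, hL.qCoeff_zero, qCoeff_matD, hL.qCoeff_zero,
    mul_one, one_mul, Finsupp.zero_apply, Nat.cast_zero, mul_zero, zero_smul, sub_zero] at h1
  rw [← h1]
  exact hConst_map_FKtoFKh _ _

theorem exists_isNormalizedGauge {qdeg : Fin r → ℕ} (hq : ∀ i, 0 < qdeg i)
    (hd : ∀ j, IsHomogeneousOp qdeg (d j)) (h : ∀ j, MvPolynomial.map (hZero r) (d j) = Rel j)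
    (hB : B.IsPolarAtZero) :
    ∃ L, B.IsNormalizedGauge L ∧ IsGraded qdeg B.weight 0 L := by
  obtain ⟨g, V, hg, hg0, hgV, hV⟩ := exists_gauge hq B.isFlat_hOmegaF (B.isGraded_hOmegaF hd)
    ((isPolarAtZero_iff h B).1 hB)
  have hgu : IsUnit g := isUnit_of_unipotent (hg.strictlyTriangular hq hg0)
  have hQu : IsUnit (Q₀F g) := hgu.map (hZeroF r).mapMatrix
  refine ⟨g, ⟨hgu, by rw [← qCoeff_zero_eq, hg0], fun i => ?_⟩, hg⟩
  have h1 := congrArg (fun M => M.map (hZeroF r)) (hgV i)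
  rw [Matrix.map_sub _ (map_sub _), Matrix.map_mul, Matrix.map_mul, map_hZeroF_matD, sub_zero,
    B.hZeroF_hOmegaF h] at h1
  -- The target is free of `h`, hence determined by the gauge equation at `h = 0`, where the
  -- derivative term disappears.
  have h2 : (V i).map (hZeroF r) = Q₀F g * (B.omega i).map (toFK r) * (Q₀F g)⁻¹ := by
    rw [Q₀F, ← h1, Matrix.mul_nonsing_inv_cancel_right]
    exact (Matrix.isUnit_iff_isUnit_det _).1 hQu
  rw [← h2, ← eq_map_FKtoFKh (hV i)]
  exact hgV i

/-- By uniqueness, any normalized gauge transformation is the homogeneous one constructed above. -/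
theorem IsNormalizedGauge.isGraded {qdeg : Fin r → ℕ} (hq : ∀ i, 0 < qdeg i)
    (hd : ∀ j, IsHomogeneousOp qdeg (d j)) (h : ∀ j, MvPolynomial.map (hZero r) (d j) = Rel j)
    {L : Matrix (Fin (s + 1)) (Fin (s + 1)) (FKh r)} (hL : B.IsNormalizedGauge L) :
    IsGraded qdeg B.weight 0 L := by
  obtain ⟨L', hL', hgr⟩ := exists_isNormalizedGauge hq hd h (hL.isPolarAtZero h)
  rwa [hL.unique hd hL']

end StandardBasis

/-! ### Polynomiality -/

theorem exists_toFKh_eq {f : FKh r} {N : ℕ}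
    (hf : ∀ a m, PowerSeries.coeff m (MvPowerSeries.coeff a f) ≠ 0 →
      a.degree ≤ N ∧ m ≤ N) : ∃ p : Kh r, toFKh r p = f := by
  classical
  have hfin : {a : Fin r →₀ ℕ | a.degree ≤ N}.Finite := Finsupp.finite_of_degree_le N
  refine ⟨∑ a ∈ hfin.toFinset, MvPolynomial.monomial a
    (PowerSeries.trunc (N + 1) (MvPowerSeries.coeff a f)), FKh_ext fun a m => ?_⟩
  rw [coeff_toFKh, MvPolynomial.coeff_sum]
  simp only [MvPolynomial.coeff_monomial]
  rw [Finset.sum_ite_eq']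
  by_contra hne
  split_ifs at hne with ha
  · rw [PowerSeries.coeff_trunc] at hne
    split_ifs at hne with hm
    · exact hne rfl
    · have := (hf a m (Ne.symm hne)).2
      omega
  · rw [Polynomial.coeff_zero] at hne
    exact ha (hfin.mem_toFinset.2 (hf a m (Ne.symm hne)).1)

theorem IsGraded.exists_toFKh_eq {ι : Type*} [Fintype ι] {qdeg : Fin r → ℕ}
    (hq : ∀ i, 0 < qdeg i) {n : ι → ℕ} {e : ℕ} {M : Matrix ι ι (FKh r)}
    (h : IsGraded qdeg n e M) : ∃ N : Matrix ι ι (Kh r), N.map (toFKh r) = M := by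
  have : ∀ k j, ∃ p : Kh r, toFKh r p = M k j := fun k j =>
    DQuant.exists_toFKh_eq (N := 2 * n j + e) fun a m hne => by
      have h1 := h k j a m hne
      have h2 := mul_degree_le_qWeight (c := 1) hq a
      omega
  choose p hp using this
  exact ⟨Matrix.of p, by ext k j : 1; exact hp k j⟩

/-- Unipotence is pulled back along the injection into power series, so the inverse already exists
over `K[h]`. -/
theorem isUnit_of_map_toFKh {ι : Type*} [Fintype ι] [DecidableEq ι] {qdeg : Fin r → ℕ}
    (hq : ∀ i, 0 < qdeg i) {n : ι → ℕ} {M : Matrix ι ι (Kh r)}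
    (h : IsGraded qdeg n 0 (M.map (toFKh r))) (h0 : qCoeff 0 (M.map (toFKh r)) = 1) :
    IsUnit M := by
  refine isUnit_of_unipotent (n := n) fun k j hne => h.strictlyTriangular hq h0 k j fun h1 => ?_
  refine hne (toFKh_injective ?_)
  have h2 : (M - 1).map (toFKh r) = M.map (toFKh r) - 1 := by
    rw [Matrix.map_sub _ (map_sub _), Matrix.map_one _ (map_zero _) (map_one _)]
  rw [map_zero, ← h1, ← h2, Matrix.map_apply]

/-- The columns of weight at most `1` of a homogeneous matrix that is the identity at `q = 0` are
those of the identity, as `q_i` has degree at least `4`. -/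
theorem map_hZero_apply_eq_one {ι : Type*} [Fintype ι] [DecidableEq ι] {qdeg : Fin r → ℕ}
    (hq : ∀ i, 4 ≤ qdeg i) {n : ι → ℕ} {M : Matrix ι ι (Kh r)}
    (h : IsGraded qdeg n 0 (M.map (toFKh r))) (h0 : qCoeff 0 (M.map (toFKh r)) = 1) {j : ι}
    (hj : n j ≤ 1) (k : ι) : M.map (hZero r) k j = (1 : Matrix ι ι (K r)) k j := by
  classical
  have hc : ∀ a, (M.map (hZero r) k j).coeff a =
      PowerSeries.coeff 0 (MvPowerSeries.coeff a (M.map (toFKh r) k j)) := fun a => by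
    rw [Matrix.map_apply, Matrix.map_apply, coeff_toFKh, hZero, MvPolynomial.coeff_map]
    rfl
  refine MvPolynomial.ext _ _ fun a => ?_
  rw [hc]
  by_cases ha : a = 0
  · subst ha
    rw [← qCoeff_apply, h0, Matrix.one_apply, Matrix.one_apply]
    split_ifs <;> simp
  · have h1 : PowerSeries.coeff 0 (MvPowerSeries.coeff a (M.map (toFKh r) k j)) = 0 := by
      by_contra hne
      have h2 := h k j a 0 hne
      have h3 := mul_degree_le_qWeight hq a
      have h4 : a.degree ≠ 0 := fun h5 => ha ((Finsupp.degree_eq_zero_iff a).1 h5)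
      omega
    rw [h1, Matrix.one_apply]
    split_ifs
    · rw [MvPolynomial.coeff_one, if_neg (Ne.symm ha)]
    · rw [MvPolynomial.coeff_zero]

theorem inv_apply_eq_one {ι R : Type*} [Fintype ι] [DecidableEq ι] [CommRing R] {M : Matrix ι ι R}
    (hM : IsUnit M) {j : ι} (h : ∀ k, M k j = (1 : Matrix ι ι R) k j) (k : ι) :
    M⁻¹ k j = (1 : Matrix ι ι R) k j := by
  have h1 : M⁻¹ * M = 1 := Matrix.nonsing_inv_mul _ ((Matrix.isUnit_iff_isUnit_det _).1 hM)
  rw [← h1, Matrix.mul_apply]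
  simp [h, Matrix.one_apply]

theorem StandardBasis.cHat_eq_monomial (B : StandardBasis Rel d s)
    {Q : Matrix (Fin (s + 1)) (Fin (s + 1)) (K r)} (hQ : IsUnit Q) {j : Fin (s + 1)}
    (h : ∀ k, Q k j = (1 : Matrix (Fin (s + 1)) (Fin (s + 1)) (K r)) k j) :
    B.cHat Q j = MvPolynomial.monomial (B.exp j) 1 := by
  rw [StandardBasis.cHat, Finset.sum_eq_single j]
  · rw [inv_apply_eq_one hQ h, Matrix.one_apply_eq]
  · intro k _ hk
    rw [inv_apply_eq_one hQ h, Matrix.one_apply_ne hk, MvPolynomial.monomial_zero]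
  · simp

end

noncomputable section

variable {r u s : ℕ} {Rel : Fin u → MvPolynomial (Fin r) (K r)}
  {d : Fin u → MvPolynomial (Fin r) (Kh r)}

/-! ## The specialization at `q = 0` -/

/-- The specialization at `q = 0`, from `𝒜` to `𝒜₀`. -/
def qZeroA (Rel : Fin u → MvPolynomial (Fin r) (K r)) : Alg Rel →+* AlgZero Rel :=
  Ideal.quotientMap _ (MvPolynomial.map (qZero r)) (by
    rw [Ideal.span_le]
    rintro _ ⟨j, rfl⟩
    exact Ideal.subset_span ⟨j, rfl⟩)

theorem qZeroA_cls (c : MvPolynomial (Fin r) (K r)) :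
    qZeroA Rel (cls Rel c) = clsZero Rel (MvPolynomial.map (qZero r) c) := rfl

theorem C_smul_eq (c : ℂ) (x : AlgZero Rel) : c • x = clsZero Rel (MvPolynomial.C c) * x := by
  obtain ⟨p, rfl⟩ := Ideal.Quotient.mk_surjective x
  change clsZero Rel (c • p) = _
  rw [MvPolynomial.smul_eq_C_mul]
  exact map_mul (Ideal.Quotient.mk _) _ _

theorem qZeroA_smul (c : K r) (x : Alg Rel) : qZeroA Rel (c • x) = qZero r c • qZeroA Rel x := by
  rw [K_smul_eq, map_mul, qZeroA_cls, MvPolynomial.map_C, C_smul_eq]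

theorem qZeroA_surjective : Function.Surjective (qZeroA Rel) := by
  intro x
  obtain ⟨p, rfl⟩ := Ideal.Quotient.mk_surjective x
  refine ⟨cls Rel (MvPolynomial.map MvPolynomial.C p), ?_⟩
  rw [qZeroA_cls, MvPolynomial.map_map]
  have : (qZero r).comp MvPolynomial.C = RingHom.id ℂ :=
    RingHom.ext fun z => MvPolynomial.constantCoeff_C _ z
  rw [this, MvPolynomial.map_id]
  rfl

/-! ## Linear independence of `1, b₁, …, b_r` and of `1, h∂₁, …, h∂_r` -/

theorem isHomogeneous_relZero {qdeg : Fin r → ℕ} (hd : ∀ j, IsHomogeneousOp qdeg (d j))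
    (h : ∀ j, MvPolynomial.map (hZero r) (d j) = Rel j) (j : Fin u) :
    ∃ m, (relZero Rel j).IsHomogeneous m := by
  obtain ⟨m, hm⟩ := hd j
  refine ⟨m / 2, fun I hI => ?_⟩
  have h1 : (relZero Rel j).coeff I = (((d j).coeff I).coeff 0).coeff 0 := by
    rw [relZero, ← h j, MvPolynomial.coeff_map, MvPolynomial.coeff_map, hZero, qZero,
      MvPolynomial.constantCoeff_map]
    rfl
  have h2 := hm I 0 0 (h1 ▸ hI)
  have h3 : Finsupp.weight 1 I = I.degree :=
    (congrArg (fun g => g I) (Finsupp.degree_eq_weight_one (R := ℕ))).symm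
  have h4 : ∑ i, qdeg i * (0 : Fin r →₀ ℕ) i = 0 := by simp
  rw [h3]
  omega

/-- The relations at `q = 0` are homogeneous, so the ideal contains the constant term of each of its
elements; a nonzero constant would make it the unit ideal. -/
theorem coeff_zero_eq_zero_of_clsZero_eq_zero {qdeg : Fin r → ℕ}
    (hd : ∀ j, IsHomogeneousOp qdeg (d j))
    (h : ∀ j, MvPolynomial.map (hZero r) (d j) = Rel j) [Nontrivial (AlgZero Rel)]
    {p : MvPolynomial (Fin r) ℂ} (hp : clsZero Rel p = 0) : p.coeff 0 = 0 := by
  let _ := MvPolynomial.gradedAlgebra (σ := Fin r) (R := ℂ)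
  have hI : (Ideal.span (Set.range (relZero Rel))).IsHomogeneous
      (MvPolynomial.homogeneousSubmodule (Fin r) ℂ) := by
    refine Ideal.homogeneous_span _ _ ?_
    rintro _ ⟨j, rfl⟩
    obtain ⟨m, hm⟩ := isHomogeneous_relZero hd h j
    exact ⟨m, hm⟩
  have h1 := hI 0 (Ideal.Quotient.eq_zero_iff_mem.1 hp)
  have h2 : ((DirectSum.decompose (MvPolynomial.homogeneousSubmodule (Fin r) ℂ) p 0 :
      MvPolynomial.homogeneousSubmodule (Fin r) ℂ 0) : MvPolynomial (Fin r) ℂ) =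
      MvPolynomial.C (p.coeff 0) := by
    rw [← MvPolynomial.homogeneousComponent_zero]
    exact MvPolynomial.decomposition.decompose'_apply p 0
  rw [h2] at h1
  by_contra hne
  refine one_ne_zero (α := AlgZero Rel) ?_
  have h3 := Ideal.mul_mem_left _ (MvPolynomial.C (p.coeff 0)⁻¹) h1
  rw [← map_mul, inv_mul_cancel₀ hne, map_one] at h3
  exact Ideal.Quotient.eq_zero_iff_mem.2 h3

/-- The exponents of `1, b₁, …, b_r`. -/
def lowExp (r : ℕ) : Fin (r + 1) → (Fin r →₀ ℕ) := Fin.cons 0 fun i => Finsupp.single i 1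

theorem lowExp_zero : lowExp r 0 = 0 := rfl

theorem lowExp_succ (i : Fin r) : lowExp r i.succ = Finsupp.single i 1 := rfl

theorem lowExp_injective : Function.Injective (lowExp r) := by
  intro l l' h
  cases l using Fin.cases with
  | zero =>
    cases l' using Fin.cases with
    | zero => rfl
    | succ i => simp [lowExp_zero, lowExp_succ, eq_comm] at h
  | succ i =>
    cases l' using Fin.cases with
    | zero => simp [lowExp_zero, lowExp_succ] at h
    | succ i' =>
      rw [lowExp_succ, lowExp_succ, Finsupp.single_left_inj one_ne_zero] at h
      rw [h]

theorem exists_lowExp_eq {J : Fin r →₀ ℕ} (h : J.degree ≤ 1) : ∃ l, lowExp r l = J := by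
  by_cases h0 : J = 0
  · exact ⟨0, h0.symm⟩
  · obtain ⟨i, hi⟩ := Finsupp.ne_iff.1 h0
    have h1 : Finsupp.single i 1 + (J - Finsupp.single i 1) = J :=
      add_tsub_cancel_of_le (Finsupp.single_le_iff.2 (Nat.one_le_iff_ne_zero.2 hi))
    have h2 : (J - Finsupp.single i 1).degree = 0 := by
      rw [← h1, map_add, Finsupp.degree_single] at h
      omega
    rw [(Finsupp.degree_eq_zero_iff _).1 h2, add_zero] at h1
    exact ⟨i.succ, h1⟩

theorem degree_lowExp_le (l : Fin (r + 1)) : (lowExp r l).degree ≤ 1 := by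
  cases l using Fin.cases with
  | zero => simp [lowExp_zero]
  | succ i => simp [lowExp_succ]

theorem linearIndependent_lowExp {qdeg : Fin r → ℕ} (hd : ∀ j, IsHomogeneousOp qdeg (d j))
    (h : ∀ j, MvPolynomial.map (hZero r) (d j) = Rel j) [Nontrivial (AlgZero Rel)]
    (hb : LinearIndependent ℂ fun i : Fin r => clsZero Rel (MvPolynomial.X i)) :
    LinearIndependent ℂ fun l => clsZero Rel (MvPolynomial.monomial (lowExp r l) 1) := by
  have h1 : (fun l => clsZero Rel (MvPolynomial.monomial (lowExp r l) 1)) =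
      Fin.cons (1 : AlgZero Rel) fun i : Fin r => clsZero Rel (MvPolynomial.X i) := by
    funext l
    cases l using Fin.cases with
    | zero => rfl
    | succ i => rfl
  rw [h1, linearIndependent_finCons]
  refine ⟨hb, fun hmem => ?_⟩
  obtain ⟨β, hβ⟩ := (Submodule.mem_span_range_iff_exists_fun ℂ).1 hmem
  have h2 : clsZero Rel (∑ i, β i • MvPolynomial.X i - 1) = 0 := by
    rw [clsZero, map_sub, map_sum, map_one, sub_eq_zero]
    exact hβ
  have h3 := coeff_zero_eq_zero_of_clsZero_eq_zero hd h h2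
  rw [MvPolynomial.coeff_sub, MvPolynomial.coeff_sum, Finset.sum_eq_zero] at h3
  · simp at h3
  · intro i _
    simp

theorem exists_matrix_mul_eq_one_of_injective {F : Type*} [Field F] {m n : ℕ}
    {M : Matrix (Fin m) (Fin n) F} (h : ∀ v, M.mulVec v = 0 → v = 0) :
    ∃ N : Matrix (Fin n) (Fin m) F, N * M = 1 := by
  obtain ⟨g, hg⟩ := LinearMap.exists_leftInverse_of_injective (Matrix.toLin' M)
    (LinearMap.ker_eq_bot'.2 fun v hv => h v hv)
  refine ⟨LinearMap.toMatrix' g, ?_⟩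
  have := congrArg LinearMap.toMatrix' hg
  rwa [LinearMap.toMatrix'_comp, LinearMap.toMatrix'_toLin', LinearMap.toMatrix'_id] at this

/-- The coordinate matrix of the given classes is injective at `q = h = 0`, and this open condition
passes to `K[h]`. -/
theorem StandardBasis.coeff_eq_zero_of_sum_eq_zero (B : StandardBasis Rel d s)
    (h : ∀ j, MvPolynomial.map (hZero r) (d j) = Rel j) {m : ℕ} {t : Fin m → (Fin r →₀ ℕ)}
    (ht : LinearIndependent ℂ fun l => clsZero Rel (MvPolynomial.monomial (t l) 1))
    {f : Fin m → Kh r} (hf : ∑ l, f l • clsD d (monD (t l)) = 0) : f = 0 := by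
  set V : Matrix (Fin (s + 1)) (Fin m) (Kh r) :=
    Matrix.of fun k l => B.P.repr (clsD d (monD (t l))) k with hV
  set ev : Kh r →+* ℂ := (qZero r).comp (hZero r) with hev
  have hVf : V.mulVec f = 0 := by
    funext k
    have h1 := congrArg (fun x => B.P.repr x k) hf
    simp only [map_sum, map_smul, Finsupp.coe_finsetSum, Finset.sum_apply, Finsupp.smul_apply,
      smul_eq_mul, map_zero, Finsupp.zero_apply] at h1
    simp only [Matrix.mulVec, dotProduct, Pi.zero_apply]
    rw [← h1]
    exact Finset.sum_congr rfl fun l _ => mul_comm _ _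
  have hsym : ∀ l, clsZero Rel (MvPolynomial.monomial (t l) 1) =
      ∑ k, ev (V k l) • qZeroA Rel (B.c k) := by
    intro l
    have h1 := congrArg (fun x => qZeroA Rel (symM h x)) (B.P.sum_repr (clsD d (monD (t l))))
    simp only [map_sum, symM_Kh_smul, qZeroA_smul] at h1
    rw [symM_clsD, symD_monD, qZeroA_cls, MvPolynomial.map_monomial, map_one] at h1
    rw [← h1]
    refine Finset.sum_congr rfl fun k _ => ?_
    rw [B.P_apply, symM_clsD, symD_monD, B.c_apply]
    rfl
  obtain ⟨N, hN⟩ := exists_matrix_mul_eq_one_of_injective (M := V.map ev) (by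
    intro β hβ
    funext l
    refine Fintype.linearIndependent_iff.1 ht β ?_ l
    simp only [hsym, Finset.smul_sum, smul_smul]
    rw [Finset.sum_comm]
    refine Finset.sum_eq_zero fun k _ => ?_
    rw [← Finset.sum_smul]
    have h1 := congrFun hβ k
    simp only [Matrix.mulVec, dotProduct, Matrix.map_apply, Pi.zero_apply] at h1
    simp only [mul_comm (β _), h1, zero_smul])
  -- A complex left inverse, read as a constant matrix, gives a determinant with value 1 at the
  -- origin, hence a nonzero one.
  have hdet : (N.map (cst r) * V).det ≠ 0 := by
    intro h0
    have hevc : (N.map (cst r)).map ev = N := by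
      ext i j : 1
      simp [hev, cst, hZero, qZero]
    have h1 := congrArg ev h0
    rw [RingHom.map_det, RingHom.mapMatrix_apply, Matrix.map_mul, hevc, hN, Matrix.det_one,
      map_zero] at h1
    exact one_ne_zero h1
  refine Matrix.eq_zero_of_mulVec_eq_zero hdet ?_
  rw [← Matrix.mulVec_mulVec, hVf, Matrix.mulVec_zero]

theorem StandardBasis.lowExp_mem_standardExps (B : StandardBasis Rel d s)
    (h : ∀ j, MvPolynomial.map (hZero r) (d j) = Rel j)
    (hl : LinearIndependent ℂ fun l => clsZero Rel (MvPolynomial.monomial (lowExp r l) 1))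
    (l : Fin (r + 1)) : lowExp r l ∈ standardExps d := by
  classical
  intro f hf ⟨hI, hlead⟩
  -- The order compares degrees first, so an operator with leading exponent of degree at most one
  -- involves only `1, h∂_1, …, h∂_r`.
  have hsupp : ∀ J ∈ f.support, ∃ l, lowExp r l = J := by
    intro J hJ
    refine exists_lowExp_eq ?_
    have h1 := degree_lowExp_le l
    by_cases hJl : J = lowExp r l
    · rwa [hJl]
    · rcases hlead J hJ hJl with h2 | ⟨h2, -⟩ <;> omega
  have hsum : op f = ∑ l, coeffD r (f.coeff (lowExp r l)) * monD (lowExp r l) := by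
    rw [op]
    have himg : f.support ⊆ Finset.univ.image (lowExp r) := fun J hJ => by
      obtain ⟨l, rfl⟩ := hsupp J hJ
      exact Finset.mem_image_of_mem _ (Finset.mem_univ l)
    rw [Finset.sum_subset himg, Finset.sum_image fun _ _ _ _ h => lowExp_injective h]
    intro J _ hJ
    rw [MvPolynomial.notMem_support_iff.1 hJ, map_zero, zero_mul]
  have h0 : ∑ l, f.coeff (lowExp r l) • clsD d (monD (lowExp r l)) = 0 := by
    have h1 : clsD d (op f) = 0 := (Submodule.Quotient.mk_eq_zero _).2 hf
    rw [hsum] at h1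
    rw [← h1]
    exact (map_sum (leftIdeal d).mkQ _ _).symm
  have h2 := congrFun (B.coeff_eq_zero_of_sum_eq_zero h hl h0) l
  exact MvPolynomial.mem_support_iff.1 hI h2

/-! ### Adapted numberings -/

/-- Renumbering the standard monomials. -/
def StandardBasis.reindex (B : StandardBasis Rel d s) (e : Equiv.Perm (Fin (s + 1))) :
    StandardBasis Rel d s where
  exp := B.exp ∘ e
  injective := B.injective.comp e.injective
  range_eq := by rw [e.surjective.range_comp, B.range_eq]
  P := B.P.reindex e.symm
  P_apply j := by rw [Module.Basis.reindex_apply, Equiv.symm_symm, B.P_apply]; rfl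
  c := B.c.reindex e.symm
  c_apply j := by rw [Module.Basis.reindex_apply, Equiv.symm_symm, B.c_apply]; rfl

theorem exists_perm_castLE {m n : ℕ} (κ : Fin m → Fin (n + 1)) (hκ : Function.Injective κ) :
    ∃ (hmn : m ≤ n + 1) (e : Equiv.Perm (Fin (n + 1))), ∀ l, e (Fin.castLE hmn l) = κ l := by
  classical
  have hmn : m ≤ n + 1 := by simpa using Fintype.card_le_of_injective κ hκ
  refine ⟨hmn, ?_⟩
  obtain ⟨g, hg⟩ := Finset.exists_equiv_extend_of_card_eq (α := Fin (n + 1)) (β := Fin (n + 1))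
    (t := Finset.univ) (by simp) (s := Finset.univ.image (Fin.castLE hmn))
    -- The default value 0 is harmless: the extension only has to agree with this function on the
    -- first `m` indices.
    (f := fun i => if hi : (i : ℕ) < m then κ ⟨i, hi⟩ else 0) (Finset.subset_univ _) (by
      intro i hi j hj hij
      simp only [Finset.coe_image, Finset.coe_univ, Set.image_univ, Set.mem_range] at hi hj
      obtain ⟨i, rfl⟩ := hi
      obtain ⟨j, rfl⟩ := hj
      simp only [Fin.val_castLE, Fin.is_lt, dite_true, Fin.eta] at hij
      rw [hκ hij])
  refine ⟨g.trans (Equiv.subtypeUnivEquiv Finset.mem_univ), fun l => ?_⟩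
  have := hg (Fin.castLE hmn l) (Finset.mem_image_of_mem _ (Finset.mem_univ l))
  simp only [Fin.val_castLE, Fin.is_lt, dite_true, Fin.eta] at this
  exact this

theorem StandardBasis.exists_isAdapted (B : StandardBasis Rel d s)
    (h : ∀ l, lowExp r l ∈ standardExps d) : ∃ B : StandardBasis Rel d s, B.IsAdapted := by
  have h1 : ∀ l, ∃ k, B.exp k = lowExp r l := fun l => by
    rw [← Set.mem_range, B.range_eq]
    exact h l
  choose κ hκ using h1
  have hinj : Function.Injective κ := fun l l' hl => lowExp_injective (by rw [← hκ, hl, hκ])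
  obtain ⟨hrs, e, he⟩ := exists_perm_castLE κ hinj
  refine ⟨B.reindex e, ?_, fun i => ⟨by omega, ?_⟩⟩
  · change B.exp (e (Fin.castLE hrs 0)) = 0
    rw [he, hκ, lowExp_zero]
  · change B.exp (e (Fin.castLE hrs i.succ)) = _
    rw [he, hκ, lowExp_succ]

/-! ## The change of basis `δ` -/

namespace StandardBasis

/-- The basis `[ĉ_j]` of `𝒜`. -/
def cHatBasis (B : StandardBasis Rel d s) {Q : Matrix (Fin (s + 1)) (Fin (s + 1)) (K r)}
    (hQ : IsUnit Q) : Module.Basis (Fin (s + 1)) (K r) (Alg Rel) :=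
  B.c.map (Matrix.toLinearEquiv B.c Q⁻¹
    (Matrix.isUnit_nonsing_inv_det _ ((Matrix.isUnit_iff_isUnit_det _).1 hQ)))

variable (B : StandardBasis Rel d s) {Q : Matrix (Fin (s + 1)) (Fin (s + 1)) (K r)}
  (hQ : IsUnit Q)

theorem cHatBasis_eq_sum (j : Fin (s + 1)) : B.cHatBasis hQ j = ∑ k, Q⁻¹ k j • B.c k := by
  rw [cHatBasis, Module.Basis.map_apply]
  exact Matrix.toLin_self _ _ _ _

theorem cHatBasis_apply (j : Fin (s + 1)) : B.cHatBasis hQ j = cls Rel (B.cHat Q j) := by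
  rw [cHatBasis_eq_sum, cHat, cls, map_sum]
  refine Finset.sum_congr rfl fun k _ => ?_
  rw [B.c_apply, K_smul_eq]
  change cls Rel _ * _ = cls Rel _
  have h1 : MvPolynomial.monomial (B.exp k) (Q⁻¹ k j) =
      MvPolynomial.C (Q⁻¹ k j) * MvPolynomial.monomial (B.exp k) 1 := by
    rw [MvPolynomial.C_mul_monomial, mul_one]
  rw [h1]
  exact (map_mul (Ideal.Quotient.mk _) _ _).symm

theorem toMatrix_cHatBasis (f : Alg Rel →ₗ[K r] Alg Rel) :
    LinearMap.toMatrix (B.cHatBasis hQ) (B.cHatBasis hQ) f =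
      Q * LinearMap.toMatrix B.c B.c f * Q⁻¹ := by
  have hdet := (Matrix.isUnit_iff_isUnit_det _).1 hQ
  have h1 : B.c.toMatrix (B.cHatBasis hQ) = Q⁻¹ := by
    ext k j : 1
    rw [Module.Basis.toMatrix_apply, cHatBasis_eq_sum, B.c.repr_sum_self]
  have h2 : (B.cHatBasis hQ).toMatrix B.c = Q := by
    have h3 := Module.Basis.toMatrix_mul_toMatrix_flip (B.cHatBasis hQ) B.c
    rw [h1] at h3
    rw [← mul_one ((B.cHatBasis hQ).toMatrix B.c), ← Matrix.nonsing_inv_mul Q hdet, ← mul_assoc,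
      h3, one_mul]
  rw [← basis_toMatrix_mul_linearMap_toMatrix_mul_basis_toMatrix (B.cHatBasis hQ) B.c
    (B.cHatBasis hQ) B.c, h1, h2]

/-- The basis `[[c_j]]` of `𝒜₀`. -/
def cZeroBasis (h0 : Module.finrank ℂ (AlgZero Rel) = s + 1) :
    Module.Basis (Fin (s + 1)) ℂ (AlgZero Rel) :=
  basisOfTopLeSpanOfCardEqFinrank (fun j => clsZero Rel (MvPolynomial.monomial (B.exp j) 1))
    (by
      -- The specialization is surjective, so the `[[c_j]]` span; as many as the dimension, they
      -- form a basis.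
      intro x _
      obtain ⟨y, rfl⟩ := qZeroA_surjective x
      rw [← B.c.sum_repr y, map_sum]
      refine Submodule.sum_mem _ fun k _ => ?_
      rw [qZeroA_smul]
      refine Submodule.smul_mem _ _ (Submodule.subset_span ⟨k, ?_⟩)
      rw [B.c_apply, qZeroA_cls, MvPolynomial.map_monomial, map_one])
    (by rw [h0, Fintype.card_fin])

theorem cZeroBasis_apply (h0 : Module.finrank ℂ (AlgZero Rel) = s + 1) (j : Fin (s + 1)) :
    B.cZeroBasis h0 j = clsZero Rel (MvPolynomial.monomial (B.exp j) 1) := by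
  rw [cZeroBasis, coe_basisOfTopLeSpanOfCardEqFinrank]

theorem map_qZero_inv (hQ : IsUnit Q) (h1 : Q.map (qZero r) = 1) : Q⁻¹.map (qZero r) = 1 := by
  have h2 := congrArg (fun M => M.map (qZero r))
    (Matrix.mul_nonsing_inv Q ((Matrix.isUnit_iff_isUnit_det _).1 hQ))
  rw [Matrix.map_mul, h1, one_mul, Matrix.map_one _ (map_zero _) (map_one _)] at h2
  exact h2

theorem cHatZero_eq_monomial (hQ : IsUnit Q) (h1 : Q.map (qZero r) = 1) (j : Fin (s + 1)) :
    B.cHatZero Q j = MvPolynomial.monomial (B.exp j) 1 := by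
  have h2 : ∀ k, qZero r (Q⁻¹ k j) = (1 : Matrix (Fin (s + 1)) (Fin (s + 1)) ℂ) k j := fun k => by
    rw [← map_qZero_inv hQ h1, Matrix.map_apply]
  rw [cHatZero, cHat, map_sum]
  simp only [MvPolynomial.map_monomial, h2]
  rw [Finset.sum_eq_single j]
  · rw [Matrix.one_apply_eq]
  · intro k _ hk
    rw [Matrix.one_apply_ne hk, MvPolynomial.monomial_zero]
  · simp

/-- The isomorphism `δ`. -/
def deltaEquiv (h0 : Module.finrank ℂ (AlgZero Rel) = s + 1) :
    Alg Rel ≃ₗ[K r] K r ⊗[ℂ] AlgZero Rel :=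
  (B.cHatBasis hQ).equiv ((B.cZeroBasis h0).baseChange (K r)) (Equiv.refl _)

theorem deltaEquiv_cHat (h0 : Module.finrank ℂ (AlgZero Rel) = s + 1)
    (h1 : Q.map (qZero r) = 1) (j : Fin (s + 1)) :
    B.deltaEquiv hQ h0 (cls Rel (B.cHat Q j)) = 1 ⊗ₜ clsZero Rel (B.cHatZero Q j) := by
  rw [← B.cHatBasis_apply hQ, deltaEquiv, Module.Basis.equiv_apply, Equiv.refl_apply,
    Module.Basis.baseChange_apply, cZeroBasis_apply, B.cHatZero_eq_monomial hQ h1]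

end StandardBasis

theorem map_qZero_map_hZero {ι : Type*} [Fintype ι] [DecidableEq ι] {M : Matrix ι ι (Kh r)}
    (h0 : qCoeff 0 (M.map (toFKh r)) = 1) : (M.map (hZero r)).map (qZero r) = 1 := by
  ext k j : 1
  have h1 := congrArg (PowerSeries.coeff 0) (congrFun (congrFun h0 k) j)
  rw [qCoeff_apply, Matrix.map_apply, coeff_toFKh] at h1
  rw [Matrix.map_apply, Matrix.map_apply, hZero, qZero, MvPolynomial.constantCoeff_map]
  refine h1.trans ?_
  rw [Matrix.one_apply, Matrix.one_apply]
  split_ifs <;> simp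

end

end DQuant

/-! ### Assembly of the corollary -/

theorem corollary4p2 (r u s : ℕ)
    -- the degrees of `q₁, …, q_r`
    (qdeg : Fin r → ℕ) (hqdeg : ∀ i, 4 ≤ qdeg i)
    -- the relations of `𝒜`, and the operators `D_j^h = op (d j)`
    (Rel : Fin u → MvPolynomial (Fin r) (K r)) (d : Fin u → MvPolynomial (Fin r) (Kh r))
    (hA : IsDeformation Rel s)
    -- `b₁, …, b_r` are linearly independent in `𝒜₀`
    (hb : LinearIndependent ℂ fun i : Fin r => clsZero Rel (MvPolynomial.X i))
    (hM : IsQuantization Rel d s)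
    (hhom : ∀ j, IsHomogeneousOp qdeg (d j))
    -- the standard monomials form a basis, so that the matrices `hΩ_i^h` are polynomial in `q`, `h`
    (hstd : Nonempty (StandardBasis Rel d s)) :
    -- one may take `P₀ = 1` and `P_i = h∂_i`
    (∃ B : StandardBasis Rel d s, B.IsAdapted) ∧
    ∀ B : StandardBasis Rel d s, B.IsAdapted →
      -- existence of the normalized gauge transformation
      ((∃ L, B.IsNormalizedGauge L) ↔ B.IsPolarAtZero) ∧
      ∀ L, B.IsNormalizedGauge L →
        -- uniqueness
        (∀ L', B.IsNormalizedGauge L' → L' = L) ∧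
        -- `L₊` and its inverse are polynomial in `q` and `h`
        ∃ Lp : Matrix (Fin (s + 1)) (Fin (s + 1)) (Kh r), Lp.map (toFKh r) = L ∧ IsUnit Lp ∧
        ∃ Q₀ : Matrix (Fin (s + 1)) (Fin (s + 1)) (K r), Q₀ = Lp.map (hZero r) ∧ IsUnit Q₀ ∧
        -- `ĉ₀ = c₀ = 1` and `ĉ_i = c_i = b_i`
        B.cHat Q₀ 0 = 1 ∧ B.c 0 = cls Rel 1 ∧
        (∀ i : Fin r, ∃ hi : (i : ℕ) + 1 < s + 1, B.cHat Q₀ ⟨i + 1, hi⟩ = MvPolynomial.X i ∧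
          B.c ⟨i + 1, hi⟩ = cls Rel (MvPolynomial.X i)) ∧
        -- the `[ĉ_j]` are a basis of `𝒜`, in which `b_i` has the matrix `Q₀ ω_i Q₀⁻¹`
        (∃ C : Module.Basis (Fin (s + 1)) (K r) (Alg Rel), (∀ j, C j = cls Rel (B.cHat Q₀ j)) ∧
          ∀ i, LinearMap.toMatrix C C (LinearMap.mulLeft (K r) (cls Rel (MvPolynomial.X i))) =
            Q₀ * B.omega i * Q₀⁻¹) ∧
        -- the quantum product is the product of `𝒜`, transported by the change of basis `δ`
        ∃ δ : Alg Rel ≃ₗ[K r] TensorProduct ℂ (K r) (AlgZero Rel),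
          (∀ j, δ (cls Rel (B.cHat Q₀ j)) = 1 ⊗ₜ clsZero Rel (B.cHatZero Q₀ j)) ∧
          δ 1 = 1 ∧
          (∀ i, δ (cls Rel (MvPolynomial.X i)) = 1 ⊗ₜ clsZero Rel (MvPolynomial.X i)) ∧
          (∀ x y, δ (x * y) = qProd δ (δ x) (δ y)) ∧
          ∀ i j, qProd δ (1 ⊗ₜ clsZero Rel (MvPolynomial.X i))
              (1 ⊗ₜ clsZero Rel (B.cHatZero Q₀ j)) =
            ∑ k, (Q₀ * B.omega i * Q₀⁻¹) k j •
              ((1 : K r) ⊗ₜ[ℂ] clsZero Rel (B.cHatZero Q₀ k)) := by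
  have hq : ∀ i, 0 < qdeg i := fun i => by have := hqdeg i; omega
  have hlim := hM.limit
  have h0 := hA.rank_zero
  have hnt : Nontrivial (AlgZero Rel) :=
    Module.nontrivial_of_finrank_pos (R := ℂ) (by rw [h0]; exact Nat.succ_pos s)
  have hlow := linearIndependent_lowExp hhom hlim hb
  obtain ⟨B₀⟩ := hstd
  refine ⟨B₀.exists_isAdapted (B₀.lowExp_mem_standardExps hlim hlow), fun B hB => ⟨⟨?_, ?_⟩, ?_⟩⟩
  · rintro ⟨L, hL⟩
    exact hL.isPolarAtZero hlim
  · intro hpol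
    obtain ⟨L, hL, -⟩ := StandardBasis.exists_isNormalizedGauge hq hhom hlim hpol
    exact ⟨L, hL⟩
  intro L hL
  refine ⟨fun L' hL' => hL'.unique hhom hL, ?_⟩
  have hgr := hL.isGraded hq hhom hlim
  obtain ⟨Lp, rfl⟩ := hgr.exists_toFKh_eq hq
  have hL0 := hL.qCoeff_zero
  have hLp : IsUnit Lp := isUnit_of_map_toFKh hq hgr hL0
  refine ⟨Lp, rfl, hLp, Lp.map (hZero r), rfl, ?_⟩
  have hQ : IsUnit (Lp.map (hZero r)) := hLp.map (hZero r).mapMatrix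
  generalize hQdef : Lp.map (hZero r) = Q at hQ
  have hQ0 : Q.map (qZero r) = 1 := by rw [← hQdef]; exact map_qZero_map_hZero hL0
  -- Weights 0 and 1 are those of `1` and the `h∂_i`; this is the only use of the bound `|q_i| ≥ 4`
  -- beyond positivity.
  have hcol : ∀ j, B.weight j ≤ 1 → B.cHat Q j = MvPolynomial.monomial (B.exp j) 1 := fun j hj =>
    B.cHat_eq_monomial hQ fun k => by
      rw [← hQdef]
      exact map_hZero_apply_eq_one hqdeg hgr hL0 hj k
  have hc0 : B.cHat Q 0 = 1 := by
    rw [hcol 0 (by rw [StandardBasis.weight, hB.1]; simp), hB.1]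
    rfl
  have hci : ∀ i : Fin r, ∃ hi : (i : ℕ) + 1 < s + 1,
      B.cHat Q ⟨i + 1, hi⟩ = MvPolynomial.X i ∧ B.exp ⟨i + 1, hi⟩ = Finsupp.single i 1 := by
    intro i
    obtain ⟨hi, he⟩ := hB.2 i
    refine ⟨hi, ?_, he⟩
    rw [hcol _ (by rw [StandardBasis.weight, he, Finsupp.degree_single]), he]
    rfl
  have hmat := fun i => B.toMatrix_cHatBasis hQ
    (LinearMap.mulLeft (K r) (cls Rel (MvPolynomial.X i)))
  have hδ := B.deltaEquiv_cHat hQ h0 hQ0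
  have hδX : ∀ i, B.deltaEquiv hQ h0 (cls Rel (MvPolynomial.X i)) =
      1 ⊗ₜ clsZero Rel (MvPolynomial.X i) := by
    intro i
    obtain ⟨hi, he, -⟩ := hci i
    have h1 := hδ ⟨i + 1, hi⟩
    rwa [StandardBasis.cHatZero, he, MvPolynomial.map_X] at h1
  refine ⟨hQ, hc0, ?_, fun i => ?_, ⟨B.cHatBasis hQ, B.cHatBasis_apply hQ, hmat⟩,
    B.deltaEquiv hQ h0, hδ, ?_, hδX, fun x y => ?_, fun i j => ?_⟩
  · rw [B.c_apply, hB.1]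
    rfl
  · obtain ⟨hi, h1, h2⟩ := hci i
    refine ⟨hi, h1, ?_⟩
    rw [B.c_apply, h2]
    rfl
  · have h1 := hδ 0
    rw [StandardBasis.cHatZero, hc0, map_one] at h1
    exact h1
  · rw [qProd, LinearEquiv.symm_apply_apply, LinearEquiv.symm_apply_apply]
  -- Both factors are pulled back to `b_i` and `ĉ_j` in `𝒜`, where the matrix of multiplication is
  -- known.
  · rw [qProd, ← hδX, ← hδ, LinearEquiv.symm_apply_apply, LinearEquiv.symm_apply_apply]
    have h1 : cls Rel (MvPolynomial.X i) * cls Rel (B.cHat Q j) =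
        ∑ k, (Q * B.omega i * Q⁻¹) k j • cls Rel (B.cHat Q k) := by
      rw [StandardBasis.omega, ← hmat i]
      have h2 := ((B.cHatBasis hQ).sum_repr
        (cls Rel (MvPolynomial.X i) * cls Rel (B.cHat Q j))).symm
      rw [h2]
      refine Finset.sum_congr rfl fun k _ => ?_
      rw [LinearMap.toMatrix_apply, LinearMap.mulLeft_apply, B.cHatBasis_apply hQ,
        B.cHatBasis_apply hQ]
    rw [h1, map_sum]
    simp only [map_smul, hδ]
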